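/- For $d\ge 1$ let $\mathbf{C}[x]_d$ be the space of ternary forms $f=\sum_u f_u x^u$ of degree $d$ in $x=(x_0,x_1,x_2)$ (including $0$), where $u$ runs over the set $E_d$ of exponents $u\in\mathbf{Z}_{\ge0}^3$ with $u_0+u_1+u_2=d$, and let $n_d=\binom{d+2}{2}=\#E_d$. Write $\partial_i=\partial/\partial x_i$. A polynomial in $n_d$ variables indexed by $E_d$ is evaluated at a form $f$ by substituting the coefficients $f_u$; similarly a polynomial in $3n_d$ variables is evaluated at a triple of forms. For $d\ge 2$ the discriminant $\Delta_d$ is the polynomial with integer coefficients in $n_d$ variables determined by: (a) for all $f\in\mathbf{C}[x]_d$, $\Delta_d(f)=0$ if and only if $f,\partial_0f,\partial_1f,\partial_2f$ have a common zero $z\neq(0,0,0)$ in $\mathbf{C}^3$; (b) $\Delta_d$ is irreducible over $\mathbf{Z}$ and has content $1$; (c) $\Delta_d(x_0^d+x_1^d+x_2^d)<0$. For $d\ge 1$ the resultant $R_d$ is the polynomial with integer coefficients in $3n_d$ variables determined by: (a) for all $f_0,f_1,f_2\in\mathbf{C}[x]_d$, $R_d(f_0,f_1,f_2)=0$ if and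 only if $f_0,f_1,f_2$ have a common zero $z\neq(0,0,0)$ in $\mathbf{C}^3$; (b) $R_d$ is irreducible over $\mathbf{Z}$ and has content $1$; (c) $R_d(x_0^d,x_1^d,x_2^d)=1$. Proposition. Let $d\ge 2$. There is exactly one polynomial $\Delta_d$ and exactly one polynomial $R_{d-1}$ with these properties, and for all $f\in\mathbf{C}[x]_d$ $$\Delta_d(f) = -d^{-d^2+3d-3}\,R_{d-1}(\partial_0 f,\partial_1 f,\partial_2 f).$$ -/

import Mathlib

namespace TernaryForm

open MvPolynomial

/-- Exponents of the monomials of degree `d` in `x₀, x₁, x₂`. -/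
abbrev Exponents (d : ℕ) : Type := {u : Fin 3 →₀ ℕ // u.degree = d}

/-- The vector of degree `d` coefficients of `f`. -/
def coeffs {A : Type*} [CommRing A] (d : ℕ) (f : MvPolynomial (Fin 3) A) : Exponents d → A :=
  fun u => f.coeff u.1

/-- Value at a ternary form `f` of degree `d` of an integer polynomial in the coefficients. -/
noncomputable def evalAt {A : Type*} [CommRing A] {d : ℕ} (P : MvPolynomial (Exponents d) ℤ)
    (f : MvPolynomial (Fin 3) A) : A :=
  aeval (coeffs d f) P

/-- Value at a triple of ternary forms of degree `d` of an integer polynomial in the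
`3 * (d + 2).choose 2` coefficients; the variable `(i, u)` is the coefficient of `x ^ u` in the
form `f i`. -/
noncomputable def evalAtTriple {A : Type*} [CommRing A] {d : ℕ}
    (P : MvPolynomial (Fin 3 × Exponents d) ℤ) (f : Fin 3 → MvPolynomial (Fin 3) A) : A :=
  aeval (fun p : Fin 3 × Exponents d => coeffs d (f p.1) p.2) P

/-- The greatest common divisor of the coefficients is `1`. -/
def HasContentOne {σ : Type*} (P : MvPolynomial σ ℤ) : Prop :=
  P.support.gcd (fun m => P.coeff m) = 1

/-- `f` and its three partial derivatives have a common zero other than the origin. -/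
def IsSingular (f : MvPolynomial (Fin 3) ℂ) : Prop :=
  ∃ z : Fin 3 → ℂ, z ≠ 0 ∧ eval z f = 0 ∧ ∀ i, eval z (pderiv i f) = 0

/-- `f 0, f 1, f 2` have a common zero other than the origin. -/
def HaveCommonRoot (f : Fin 3 → MvPolynomial (Fin 3) ℂ) : Prop :=
  ∃ z : Fin 3 → ℂ, z ≠ 0 ∧ ∀ i, eval z (f i) = 0

/-- The properties that determine the discriminant `Δ_d` of ternary forms of degree `d`. -/
structure IsDiscriminant (d : ℕ) (Δ : MvPolynomial (Exponents d) ℤ) : Prop where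
  eval_eq_zero_iff : ∀ f : MvPolynomial (Fin 3) ℂ, f.IsHomogeneous d →
    (evalAt Δ f = 0 ↔ IsSingular f)
  irreducible : Irreducible Δ
  content : HasContentOne Δ
  neg : evalAt Δ (X 0 ^ d + X 1 ^ d + X 2 ^ d : MvPolynomial (Fin 3) ℤ) < 0

/-- The properties that determine the resultant `R_d` of three ternary forms of degree `d`. -/
structure IsResultant (d : ℕ) (R : MvPolynomial (Fin 3 × Exponents d) ℤ) : Prop where
  eval_eq_zero_iff : ∀ f : Fin 3 → MvPolynomial (Fin 3) ℂ, (∀ i, (f i).IsHomogeneous d) →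
    (evalAtTriple R f = 0 ↔ HaveCommonRoot f)
  irreducible : Irreducible R
  content : HasContentOne R
  normalized : evalAtTriple R (fun i => (X i ^ d : MvPolynomial (Fin 3) ℤ)) = 1

end TernaryForm

/-!
The resultant is defined as a generator of the kernel of the map which evaluates an integer
polynomial at the generic triple of forms vanishing at a generic point. This kernel is a prime
ideal, and it is principal because it contains the Macaulay determinants, one of which is `1` at
`(x₀ ^ d₀, x₁ ^ d₁, x₂ ^ d₂)`. Macaulay determinants also show that the resultant vanishes only at
triples with a common zero.

For a form `f` of degree `n`, Euler's relation gives
`Res(x₀, ∂₁f, ∂₂f) * Res(∂₀f, ∂₁f, ∂₂f) = n ^ (n - 1) ^ 2 * Res(f, ∂₁f, ∂₂f)`, and on the line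
`x₀ = 0` it gives
`n * a * Res(x₀, ∂₁f, ∂₂f) = n ^ (n - 1) * Res(x₀, f, ∂₂f)`, where `a` is the coefficient of
`x₂ ^ n`. The polynomials `Res(f, ∂₁f, ∂₂f)` and `Res(x₀, f, ∂₂f)` have content `1`, because modulo
each prime they do not vanish at a suitable form. Hence the content of `Res(∂₀f, ∂₁f, ∂₂f)` is
`n ^ ((n - 1) ^ 2 - (n - 2))`. Its zero set is parametrised by the generic singular form, so the
primitive part is up to sign a power of a prime polynomial, and it is that prime itself because
`Res(f, ∂₁f, ∂₂f)` is squarefree on a suitable pencil.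
-/

namespace TernaryForm

open MvPolynomial

variable {S T : Type*} [CommRing S] [CommRing T] {d : Fin 3 → ℕ}

/-! ### Forms and their coefficients -/

instance (n : ℕ) : Finite (Exponents n) := by
  refine Set.Finite.to_subtype (s := {u : Fin 3 →₀ ℕ | u.degree = n})
    (((Finset.finsuppAntidiag Finset.univ n).finite_toSet).subset fun u hu => ?_)
  simpa [Finset.mem_finsuppAntidiag, Finsupp.degree_eq_sum] using hu

noncomputable instance (n : ℕ) : Fintype (Exponents n) := Fintype.ofFinite _

/-- The form of degree `n` with given coefficients. -/
noncomputable def ofCoeffs {n : ℕ} (c : Exponents n → S) : MvPolynomial (Fin 3) S :=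
  ∑ u, monomial u.1 (c u)

@[simp]
theorem coeffs_ofCoeffs {n : ℕ} (c : Exponents n → S) : coeffs n (ofCoeffs c) = c := by
  funext u
  simp [coeffs, ofCoeffs, coeff_sum, coeff_monomial, Subtype.ext_iff.symm]

theorem isHomogeneous_ofCoeffs {n : ℕ} (c : Exponents n → S) : (ofCoeffs c).IsHomogeneous n :=
  IsHomogeneous.sum _ _ _ fun u _ => isHomogeneous_monomial _ u.2

theorem ext_of_isHomogeneous {n : ℕ} {f g : MvPolynomial (Fin 3) S} (hf : f.IsHomogeneous n)
    (hg : g.IsHomogeneous n) (h : coeffs n f = coeffs n g) : f = g := by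
  ext u
  by_cases hu : u.degree = n
  · exact congrFun h ⟨u, hu⟩
  · rw [hf.coeff_eq_zero hu, hg.coeff_eq_zero hu]

theorem ofCoeffs_coeffs {n : ℕ} {f : MvPolynomial (Fin 3) S} (hf : f.IsHomogeneous n) :
    ofCoeffs (coeffs n f) = f :=
  ext_of_isHomogeneous (isHomogeneous_ofCoeffs _) hf (coeffs_ofCoeffs _)

theorem map_ofCoeffs (φ : S →+* T) {n : ℕ} (c : Exponents n → S) :
    map φ (ofCoeffs c) = ofCoeffs fun u => φ (c u) := by
  simp [ofCoeffs]

theorem eval_eq_sum_exponents {n : ℕ} {f : MvPolynomial (Fin 3) S} (hf : f.IsHomogeneous n)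
    (z : Fin 3 → S) : eval z f = ∑ u : Exponents n, (∏ i, z i ^ u.1 i) * coeffs n f u := by
  conv_lhs => rw [← ofCoeffs_coeffs hf]
  simp [ofCoeffs, eval_monomial, Finsupp.prod_fintype, mul_comm]

/-- Substitution into polynomials with integer coefficients. As a map into an arbitrary
commutative ring it avoids the two `ℤ`-algebra structures on a polynomial ring over `ℤ`. -/
noncomputable def subst {σ : Type*} (c : σ → S) : MvPolynomial σ ℤ →+* S :=
  eval₂Hom (Int.castRingHom S) c

@[simp]
theorem subst_X {σ : Type*} (c : σ → S) (v : σ) : subst c (X v) = c v := by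
  simp [subst]

theorem subst_C {σ : Type*} (c : σ → S) (a : ℤ) : subst c (C a) = (a : S) :=
  eval₂Hom_C ..

theorem aeval_eq_subst {σ : Type*} (c : σ → S) (P : MvPolynomial σ ℤ) :
    aeval c P = subst c P := rfl

theorem map_subst {σ : Type*} (φ : S →+* T) (c : σ → S) (P : MvPolynomial σ ℤ) :
    φ (subst c P) = subst (fun v => φ (c v)) P := by
  rw [subst, map_eval₂Hom]
  congr 2
  exact RingHom.ext_int _ _

theorem subst_X_left {σ : Type*} (P : MvPolynomial σ ℤ) : subst X P = P := by
  have : subst (X : σ → MvPolynomial σ ℤ) = RingHom.id _ := by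
    ext <;> simp
  rw [this, RingHom.id_apply]

theorem subst_rename {σ τ : Type*} (ι : σ → τ) (c : τ → S) (P : MvPolynomial σ ℤ) :
    subst c (rename ι P) = subst (fun v => c (ι v)) P := by
  simp [subst, eval₂_rename, Function.comp_def]

/-- The coefficients of a triple of forms of degrees `d 0, d 1, d 2`. -/
abbrev CoeffIndex (d : Fin 3 → ℕ) : Type := Σ i, Exponents (d i)

/-- Value of an integer polynomial in the coefficients at a triple of forms of degrees
`d 0, d 1, d 2`. -/
noncomputable def evalForms (P : MvPolynomial (CoeffIndex d) ℤ)
    (f : Fin 3 → MvPolynomial (Fin 3) S) : S :=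
  subst (fun v : CoeffIndex d => coeffs (d v.1) (f v.1) v.2) P

/-- The triple of generic forms of degrees `d 0, d 1, d 2`. -/
noncomputable def genericForms (d : Fin 3 → ℕ) (i : Fin 3) :
    MvPolynomial (Fin 3) (MvPolynomial (CoeffIndex d) ℤ) :=
  ofCoeffs fun u => X ⟨i, u⟩

theorem isHomogeneous_genericForms (d : Fin 3 → ℕ) (i : Fin 3) :
    (genericForms d i).IsHomogeneous (d i) := isHomogeneous_ofCoeffs _

theorem map_evalForms (φ : S →+* T) (P : MvPolynomial (CoeffIndex d) ℤ)
    (f : Fin 3 → MvPolynomial (Fin 3) S) :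
    φ (evalForms P f) = evalForms P fun i => map φ (f i) := by
  simp only [evalForms, coeffs, map_subst, coeff_map]

theorem evalForms_genericForms (P : MvPolynomial (CoeffIndex d) ℤ) :
    evalForms P (genericForms d) = P := by
  have : (fun v : CoeffIndex d => coeffs (d v.1) (genericForms d v.1) v.2) = X :=
    funext fun v => congrFun (coeffs_ofCoeffs _) v.2
  rw [evalForms, this, subst_X_left]

@[simp]
theorem evalForms_mul (P Q : MvPolynomial (CoeffIndex d) ℤ)
    (f : Fin 3 → MvPolynomial (Fin 3) S) :
    evalForms (P * Q) f = evalForms P f * evalForms Q f := map_mul _ _ _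

@[simp]
theorem evalForms_zero (f : Fin 3 → MvPolynomial (Fin 3) S) :
    evalForms (0 : MvPolynomial (CoeffIndex d) ℤ) f = 0 := map_zero _

theorem map_subst_genericForms {f : Fin 3 → MvPolynomial (Fin 3) S}
    (hf : ∀ i, (f i).IsHomogeneous (d i)) (i : Fin 3) :
    map (subst fun v : CoeffIndex d => coeffs (d v.1) (f v.1) v.2) (genericForms d i) = f i := by
  rw [genericForms, map_ofCoeffs]
  simpa using ofCoeffs_coeffs (hf i)

theorem isHomogeneous_update {σ ι : Type*} [DecidableEq ι] {n : ι → ℕ} {f : ι → MvPolynomial σ S}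
    (hf : ∀ i, (f i).IsHomogeneous (n i)) {k : ι} {g : MvPolynomial σ S}
    (hg : g.IsHomogeneous (n k)) (i : ι) : (Function.update f k g i).IsHomogeneous (n i) := by
  rcases eq_or_ne i k with rfl | hi
  · simpa using hg
  · simpa [hi] using hf i

theorem map_update {σ ι : Type*} [DecidableEq ι] (φ : S →+* T) (f : ι → MvPolynomial σ S) (k : ι)
    (g : MvPolynomial σ S) :
    (fun i => map φ (Function.update f k g i)) =
      Function.update (fun i => map φ (f i)) k (map φ g) :=
  funext fun i => Function.apply_update (fun _ => map φ) f k g i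

/-- The polynomials have a common zero other than the origin. -/
def HasCommonZero {σ ι : Type*} (f : ι → MvPolynomial σ S) : Prop :=
  ∃ z : σ → S, z ≠ 0 ∧ ∀ i, eval z (f i) = 0

/-! ### Macaulay determinants -/

/-- The matrix of coefficients in degree `N` of the polynomials `x ^ (g u).2 * f (g u).1`. -/
noncomputable def macaulayMatrix {N : ℕ} (g : Exponents N → Fin 3 × (Fin 3 →₀ ℕ))
    (f : Fin 3 → MvPolynomial (Fin 3) S) : Matrix (Exponents N) (Exponents N) S :=
  .of fun u w => coeffs N (monomial (g w).2 1 * f (g w).1) u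

/-- The determinant of the Macaulay matrix of the generic forms. -/
noncomputable def macaulayDet (d : Fin 3 → ℕ) {N : ℕ} (g : Exponents N → Fin 3 × (Fin 3 →₀ ℕ)) :
    MvPolynomial (CoeffIndex d) ℤ :=
  (macaulayMatrix g (genericForms d)).det

theorem map_det_macaulayMatrix (φ : S →+* T) {N : ℕ} (g : Exponents N → Fin 3 × (Fin 3 →₀ ℕ))
    (f : Fin 3 → MvPolynomial (Fin 3) S) :
    φ (macaulayMatrix g f).det = (macaulayMatrix g fun i => map φ (f i)).det := by
  rw [RingHom.map_det]
  congr 1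
  ext u w
  simp [macaulayMatrix, coeffs, ← coeff_map]

theorem evalForms_macaulayDet {N : ℕ} (g : Exponents N → Fin 3 × (Fin 3 →₀ ℕ))
    {f : Fin 3 → MvPolynomial (Fin 3) S} (hf : ∀ i, (f i).IsHomogeneous (d i)) :
    evalForms (macaulayDet d g) f = (macaulayMatrix g f).det := by
  rw [evalForms, macaulayDet, map_det_macaulayMatrix]
  simp only [map_subst_genericForms hf]

theorem det_macaulayMatrix_eq_zero [IsDomain S] {N : ℕ}
    {g : Exponents N → Fin 3 × (Fin 3 →₀ ℕ)} (hg : ∀ u, (g u).2.degree + d (g u).1 = N)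
    {f : Fin 3 → MvPolynomial (Fin 3) S} (hf : ∀ i, (f i).IsHomogeneous (d i))
    (h : HasCommonZero f) : (macaulayMatrix g f).det = 0 := by
  obtain ⟨z, hz, hzf⟩ := h
  obtain ⟨j, hj⟩ := Function.ne_iff.mp hz
  let zPow : Exponents N → S := fun u => ∏ i, z i ^ u.1 i
  have hzPow : zPow ⟨Finsupp.single j N, by simp⟩ ≠ 0 := by
    simpa [zPow, Finsupp.single_apply] using fun h => absurd h hj
  refine Matrix.exists_vecMul_eq_zero_iff.mp ⟨zPow, Function.ne_iff.mpr ⟨_, hzPow⟩, ?_⟩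
  funext w
  have hom : (monomial (g w).2 (1 : S) * f (g w).1).IsHomogeneous N :=
    hg w ▸ (isHomogeneous_monomial 1 rfl).mul (hf (g w).1)
  have := eval_eq_sum_exponents hom z
  simp only [map_mul, hzf, mul_zero] at this
  simpa [Matrix.vecMul, dotProduct, macaulayMatrix] using this.symm

theorem exists_forall_X_pow_mem_span {σ ι K : Type*} [Finite σ] [Field K] [IsAlgClosed K]
    {f : ι → MvPolynomial σ K} (h : ¬ HasCommonZero f) :
    ∃ n, ∀ i, (X i : MvPolynomial σ K) ^ n ∈ Ideal.span (Set.range f) := by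
  have hX (i : σ) : (X i : MvPolynomial σ K) ∈ (Ideal.span (Set.range f)).radical := by
    rw [← vanishingIdeal_zeroLocus_eq_radical (K := K), mem_vanishingIdeal_iff]
    intro z hz
    rw [zeroLocus_span] at hz
    have : z = 0 := by
      by_contra hne
      exact h ⟨z, hne, fun i => by simpa [aeval_eq_eval] using hz (f i) ⟨i, rfl⟩⟩
    simp [this]
  cases nonempty_fintype σ
  choose m hm using hX
  exact ⟨∑ i, m i, fun i => Ideal.pow_mem_of_pow_mem _ (hm i)
    (Finset.single_le_sum (f := m) (fun _ _ => Nat.zero_le _) (Finset.mem_univ i))⟩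

theorem monomial_mem_of_X_pow_mem {σ : Type*} [Fintype σ] {I : Ideal (MvPolynomial σ S)} {n : ℕ}
    (h : ∀ i, (X i : MvPolynomial σ S) ^ n ∈ I) {u : σ →₀ ℕ}
    (hu : Fintype.card σ * n < u.degree) : monomial u 1 ∈ I := by
  obtain ⟨i, -, hi⟩ : ∃ i ∈ Finset.univ, n < u i := by
    refine Finset.exists_lt_of_sum_lt (f := fun _ => n) ?_
    simpa [Finsupp.degree_eq_sum] using hu
  have : monomial u (1 : S) = monomial (u - Finsupp.single i n) 1 * X i ^ n := by
    rw [X_pow_eq_monomial, monomial_mul, one_mul, tsub_add_cancel_of_le (by simpa using hi.le)]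
  exact this ▸ I.mul_mem_left _ (h i)

theorem span_coeffs_monomial_mul_eq_top {ι : Type*} {d : ι → ℕ} {f : ι → MvPolynomial (Fin 3) S}
    (hf : ∀ i, (f i).IsHomogeneous (d i)) {N : ℕ}
    (hN : ∀ u : Exponents N, monomial u.1 1 ∈ Ideal.span (Set.range f)) :
    Submodule.span S (Set.range fun p : {p : ι × (Fin 3 →₀ ℕ) // p.2.degree + d p.1 = N} =>
      coeffs N (monomial p.1.2 1 * f p.1.1)) = ⊤ := by
  set V := Submodule.span S (Set.range fun p : {p : ι × (Fin 3 →₀ ℕ) // p.2.degree + d p.1 = N} =>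
    coeffs N (monomial p.1.2 1 * f p.1.1))
  let L : MvPolynomial (Fin 3) S →ₗ[S] Exponents N → S := LinearMap.pi fun u => lcoeff S u.1
  have hL : (Ideal.span (Set.range f)).restrictScalars S ≤ V.comap L := by
    rw [Ideal.span, ← Submodule.span_smul_of_span_eq_top (basisMonomials (Fin 3) S).span_eq,
      Submodule.span_le]
    rintro _ ⟨_, ⟨v, rfl⟩, _, ⟨i, rfl⟩, rfl⟩
    by_cases hv : v.degree + d i = N
    · exact Submodule.subset_span ⟨⟨(i, v), hv⟩, by simp; rfl⟩
    · have : L (monomial v 1 * f i) = 0 := funext fun u =>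
        ((isHomogeneous_monomial 1 rfl).mul (hf i)).coeff_eq_zero fun hu => hv (hu ▸ u.2)
      simp [this]
  rw [eq_top_iff, ← (Pi.basisFun S (Exponents N)).span_eq, Submodule.span_le]
  rintro _ ⟨w, rfl⟩
  have hw : Pi.basisFun S (Exponents N) w = L (monomial w.1 1) := by
    funext u
    simp [L, coeff_monomial, Pi.single_apply, Subtype.ext_iff, eq_comm]
  exact hw ▸ hL (hN w)

theorem exists_det_macaulayMatrix_ne_zero {K : Type*} [Field K] [IsAlgClosed K]
    {f : Fin 3 → MvPolynomial (Fin 3) K} (hf : ∀ i, (f i).IsHomogeneous (d i))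
    (h : ¬ HasCommonZero f) :
    ∃ (N : ℕ) (g : Exponents N → Fin 3 × (Fin 3 →₀ ℕ)),
      (∀ u, (g u).2.degree + d (g u).1 = N) ∧ (macaulayMatrix g f).det ≠ 0 := by
  obtain ⟨n, hn⟩ := exists_forall_X_pow_mem_span h
  let N := 3 * n + 1
  have hspan := span_coeffs_monomial_mul_eq_top hf (N := N) fun u =>
    monomial_mem_of_X_pow_mem hn (by simp [u.2, N])
  obtain ⟨κ, a, -, ha, hli⟩ := exists_linearIndependent' K
    fun p : {p : Fin 3 × (Fin 3 →₀ ℕ) // p.2.degree + d p.1 = N} =>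
      coeffs N (monomial p.1.2 1 * f p.1.1)
  let b : Module.Basis κ K (Exponents N → K) := .mk hli (by rw [ha, hspan])
  let e : Exponents N ≃ κ := (Pi.basisFun K (Exponents N)).indexEquiv b
  refine ⟨N, fun u => (a (e u)).1, fun u => (a (e u)).2, ?_⟩
  have hcol : LinearIndependent K (macaulayMatrix (fun u => (a (e u)).1) f).col :=
    hli.comp e e.injective
  rw [Matrix.linearIndependent_cols_iff_isUnit, Matrix.isUnit_iff_isUnit_det] at hcol
  exact hcol.ne_zero

open scoped Classical in
/-- Multipliers of Macaulay's matrix in degree `∑ i, d i`, the form `k` being used as seldom as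
possible. -/
noncomputable def macaulayChoice (d : Fin 3 → ℕ) (k : Fin 3) (u : Exponents (∑ i, d i)) :
    Fin 3 × (Fin 3 →₀ ℕ) :=
  let i := if h : ∃ j, j ≠ k ∧ d j ≤ u.1 j then h.choose else k
  (i, u.1 - Finsupp.single i (d i))

theorem le_macaulayChoice (k : Fin 3) (u : Exponents (∑ i, d i)) :
    d (macaulayChoice d k u).1 ≤ u.1 (macaulayChoice d k u).1 := by
  simp only [macaulayChoice]
  split_ifs with h
  · exact h.choose_spec.2
  · push Not at h
    by_contra! hk
    refine absurd u.2 (ne_of_lt ?_)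
    rw [Finsupp.degree_eq_sum]
    refine Finset.sum_lt_sum (fun j _ => ?_) ⟨k, Finset.mem_univ k, hk⟩
    rcases eq_or_ne j k with rfl | hj
    · exact hk.le
    · exact (h j hj).le

theorem lt_of_macaulayChoice_eq {k : Fin 3} {u : Exponents (∑ i, d i)}
    (h : (macaulayChoice d k u).1 = k) {j : Fin 3} (hj : j ≠ k) : u.1 j < d j := by
  simp only [macaulayChoice] at h
  split_ifs at h with h'
  · exact absurd h h'.choose_spec.1
  · push Not at h'
    exact h' j hj

theorem macaulayChoice_add (k : Fin 3) (u : Exponents (∑ i, d i)) :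
    (macaulayChoice d k u).2 +
      Finsupp.single (macaulayChoice d k u).1 (d (macaulayChoice d k u).1) = u.1 :=
  tsub_add_cancel_of_le (Finsupp.single_le_iff.mpr (le_macaulayChoice k u))

theorem degree_macaulayChoice (k : Fin 3) (u : Exponents (∑ i, d i)) :
    (macaulayChoice d k u).2.degree + d (macaulayChoice d k u).1 = ∑ i, d i := by
  simpa [u.2] using congrArg Finsupp.degree (macaulayChoice_add k u)

theorem det_macaulayMatrix_X_pow (k : Fin 3) :
    (macaulayMatrix (macaulayChoice d k)
      fun i => (X i ^ d i : MvPolynomial (Fin 3) S)).det = 1 := by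
  convert Matrix.det_one (n := Exponents (∑ i, d i)) (R := S)
  ext u w
  simp only [macaulayMatrix, coeffs, Matrix.of_apply, X_pow_eq_monomial, monomial_mul,
    macaulayChoice_add, coeff_monomial, Matrix.one_apply, mul_one, Subtype.ext_iff, eq_comm]

/-- The degree in the coefficients of the form `k` of the resultant. -/
def blockDegree (d : Fin 3 → ℕ) (k : Fin 3) : ℕ := ∏ i, if i = k then 1 else d i

theorem card_macaulayChoice_eq_le (k : Fin 3) :
    (Finset.univ.filter fun u => (macaulayChoice d k u).1 = k).card ≤ blockDegree d k := by
  let box : Finset (Fin 3 → ℕ) :=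
    Fintype.piFinset fun i => if i = k then {0} else Finset.range (d i)
  have hbox : box.card = blockDegree d k := by
    rw [Fintype.card_piFinset, blockDegree]
    exact Finset.prod_congr rfl fun i _ => by split_ifs <;> simp
  rw [← hbox]
  refine Finset.card_le_card_of_injOn (fun u => Function.update u.1 k 0) (fun u hu => ?_)
    fun u _ w _ h => ?_
  · simp only [Finset.coe_filter, Finset.mem_univ, true_and, Set.mem_ofPred_eq] at hu
    refine Fintype.mem_piFinset.mpr fun i => ?_
    rcases eq_or_ne i k with rfl | hi
    · simp
    · simpa [hi] using lt_of_macaulayChoice_eq hu hi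
  · have off (i) (hi : i ≠ k) : u.1 i = w.1 i := by simpa [hi] using congrFun h i
    have sum : ∑ i, u.1 i = ∑ i, w.1 i := by
      rw [← Finsupp.degree_eq_sum, ← Finsupp.degree_eq_sum, u.2, w.2]
    have atk : u.1 k = w.1 k := by
      rw [← Finset.add_sum_erase _ _ (Finset.mem_univ k),
        ← Finset.add_sum_erase _ w.1 (Finset.mem_univ k),
        Finset.sum_congr rfl fun i hi => off i (Finset.ne_of_mem_erase hi)] at sum
      exact add_right_cancel sum
    refine Subtype.ext (Finsupp.ext fun i => ?_)
    rcases eq_or_ne i k with rfl | hi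
    · exact atk
    · exact off i hi

theorem det_macaulayMatrix_update_C_mul (k : Fin 3) (c : S) (f : Fin 3 → MvPolynomial (Fin 3) S) :
    (macaulayMatrix (macaulayChoice d k) (Function.update f k (C c * f k))).det =
      c ^ (Finset.univ.filter fun u => (macaulayChoice d k u).1 = k).card *
        (macaulayMatrix (macaulayChoice d k) f).det := by
  have : macaulayMatrix (macaulayChoice d k) (Function.update f k (C c * f k)) = .of fun u w =>
      (if (macaulayChoice d k w).1 = k then c else 1) *
        macaulayMatrix (macaulayChoice d k) f u w := by
    ext u w
    simp only [macaulayMatrix, coeffs, Matrix.of_apply, Function.update_apply]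
    split_ifs with h
    · rw [h, mul_left_comm, coeff_C_mul]
    · rw [one_mul]
  rw [this, Matrix.det_mul_row, Finset.prod_ite, Finset.prod_const, Finset.prod_const_one, mul_one]

/-! ### Prime ideals that contain no polynomial free of a given variable -/

theorem exists_prime_eq_span_singleton {A : Type*} [CommRing A] [IsDomain A]
    [UniqueFactorizationMonoid A] {I : Ideal (Polynomial A)} [hI : I.IsPrime] (hne : I ≠ ⊥)
    (h : ∀ a, Polynomial.C a ∈ I → a = 0) : ∃ r, Prime r ∧ I = Ideal.span {r} := by
  obtain ⟨p, hpI, hp⟩ := hI.exists_mem_prime_of_ne_bot hne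
  have hdeg : p.natDegree ≠ 0 := fun hd => by
    rw [Polynomial.eq_C_of_natDegree_eq_zero hd] at hpI hp
    exact hp.ne_zero (by rw [h _ hpI, map_zero])
  have hprim := hp.irreducible.isPrimitive hdeg
  refine ⟨p, hp, le_antisymm (fun q hq => ?_) ((Ideal.span_singleton_le_iff_mem _).mpr hpI)⟩
  rw [Ideal.mem_span_singleton]
  by_contra hdvd
  let φ := algebraMap A (FractionRing A)
  have hcop : IsCoprime (p.map φ) (q.map φ) :=
    (hprim.irreducible_iff_irreducible_map_fraction_map.mp hp.irreducible).coprime_iff_not_dvd.mpr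
      fun hd => hdvd (hprim.dvd_of_fraction_map_dvd_fraction_map hd)
  have hres : p.resultant q ≠ 0 := fun h0 => Polynomial.resultant_ne_zero _ _ hcop <| by
    rw [Polynomial.natDegree_map_eq_of_injective (IsFractionRing.injective _ _),
      Polynomial.natDegree_map_eq_of_injective (IsFractionRing.injective _ _),
      Polynomial.resultant_map_map, h0, map_zero]
  obtain ⟨a, b, -, -, hab⟩ :=
    p.exists_mul_add_mul_eq_C_resultant q le_rfl le_rfl (Or.inl hdeg)
  exact hres (h _ (hab ▸ I.add_mem (I.mul_mem_right _ hpI) (I.mul_mem_right _ hq)))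

open scoped Classical in
/-- Polynomials as polynomials in the variable `v`, the other variables being moved to the
coefficients. -/
noncomputable def splitVar (R : Type*) [CommRing R] {σ : Type*} (v : σ) :
    MvPolynomial σ R ≃ₐ[R] Polynomial (MvPolynomial {w // w ≠ v} R) :=
  (renameEquiv R (Equiv.optionSubtypeNe v).symm).trans (optionEquivLeft R _)

theorem splitVar_symm_C {R : Type*} [CommRing R] {σ : Type*} {v : σ}
    (s : MvPolynomial {w // w ≠ v} R) :
    (splitVar R v).symm (Polynomial.C s) = rename (↑) s := by
  classical
  have : (Equiv.optionSubtypeNe v) ∘ some = ((↑) : {w // w ≠ v} → σ) :=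
    funext fun w => Equiv.optionSubtypeNe_some v w
  simp [splitVar, optionEquivLeft_symm_apply, rename_rename, this]

theorem exists_prime_eq_span_singleton_of_rename {R : Type*} [CommRing R] [IsDomain R]
    [UniqueFactorizationMonoid R] {σ : Type*} {I : Ideal (MvPolynomial σ R)} [hI : I.IsPrime]
    (hne : I ≠ ⊥) (v : σ) (h : ∀ s : MvPolynomial {w // w ≠ v} R, rename (↑) s ∈ I → s = 0) :
    ∃ r, Prime r ∧ I = Ideal.span {r} := by
  let Φ := splitVar R v
  have hJne : I.comap Φ.symm ≠ ⊥ := fun hJ => hne <| by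
    rw [← Ideal.map_comap_of_surjective Φ.symm Φ.symm.surjective I, hJ, Ideal.map_bot]
  obtain ⟨r, hr, hJr⟩ := exists_prime_eq_span_singleton hJne fun a ha =>
    h a (by simpa [Φ, Ideal.mem_comap, splitVar_symm_C] using ha)
  refine ⟨Φ.symm r, (MulEquiv.prime_iff Φ.symm).mpr hr, ?_⟩
  rw [← Ideal.map_comap_of_surjective Φ.symm Φ.symm.surjective I, hJr, Ideal.map_span,
    Set.image_singleton]

/-! ### Triples of forms with a common zero -/

/-- The linear form `∑ i, l i * x i`. -/
noncomputable def linearForm {σ : Type*} [Fintype σ] (l : σ → S) : MvPolynomial σ S :=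
  ∑ i, C (l i) * X i

section LinearForm

variable {σ : Type*} [Fintype σ]

theorem isHomogeneous_linearForm (l : σ → S) : (linearForm l).IsHomogeneous 1 :=
  IsHomogeneous.sum _ _ _ fun i _ => (isHomogeneous_X S i).C_mul _

@[simp]
theorem eval_linearForm (z l : σ → S) : eval z (linearForm l) = ∑ i, l i * z i := by
  simp [linearForm]

@[simp]
theorem map_linearForm (φ : S →+* T) (l : σ → S) :
    map φ (linearForm l) = linearForm fun i => φ (l i) := by
  simp [linearForm]

/-- The form `ℓ(z) ^ n * f - f(z) * ℓ ^ n`, where `ℓ` is the linear form with coefficients `l`.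
For `f` of degree `n` and generic `l` this is the generic way to obtain a form vanishing at `z`
without dividing. -/
noncomputable def forceZero (n : ℕ) (f : MvPolynomial σ S) (z l : σ → S) : MvPolynomial σ S :=
  C (eval z (linearForm l) ^ n) * f - C (eval z f) * linearForm l ^ n

theorem isHomogeneous_forceZero {n : ℕ} {f : MvPolynomial σ S} (hf : f.IsHomogeneous n)
    (z l : σ → S) : (forceZero n f z l).IsHomogeneous n := by
  have hl := (isHomogeneous_linearForm l).pow n
  rw [one_mul] at hl
  exact (hf.C_mul _).sub (hl.C_mul _)

theorem eval_forceZero (n : ℕ) (f : MvPolynomial σ S) (z l : σ → S) :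
    eval z (forceZero n f z l) = 0 := by
  simp [forceZero, mul_comm]

theorem map_forceZero (φ : S →+* T) (n : ℕ) (f : MvPolynomial σ S) (z l : σ → S) :
    map φ (forceZero n f z l) = forceZero n (map φ f) (φ ∘ z) (φ ∘ l) := by
  simp only [forceZero, map_sub, map_mul, map_pow, map_C, map_linearForm,
    map_eval φ, Function.comp_def]

theorem forceZero_of_eval_eq_zero {n : ℕ} {f : MvPolynomial σ S} {z l : σ → S}
    (hf : eval z f = 0) (hl : eval z (linearForm l) = 1) : forceZero n f z l = f := by
  rw [forceZero, hf, hl, one_pow, C_1, C_0, one_mul, zero_mul, sub_zero]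

theorem exists_eval_linearForm_eq_one {K : Type*} [Field K] {z : σ → K} (hz : z ≠ 0) :
    ∃ l, eval z (linearForm l) = 1 := by
  classical
  obtain ⟨j, hj⟩ := Function.ne_iff.mp hz
  exact ⟨Pi.single j (z j)⁻¹, by simp [Pi.single_apply, inv_mul_cancel₀ hj]⟩

end LinearForm

/-- The generic triple of forms with a common zero: both the zero and the linear form used in
`forceZero` have independent variables as coordinates. -/
noncomputable def incidentForms (d : Fin 3 → ℕ) (i : Fin 3) :
    MvPolynomial (Fin 3) (MvPolynomial (CoeffIndex d ⊕ (Fin 3 ⊕ Fin 3)) ℤ) :=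
  forceZero (d i) (ofCoeffs fun u => X (.inl ⟨i, u⟩)) (fun j => X (.inr (.inl j)))
    fun j => X (.inr (.inr j))

theorem isHomogeneous_incidentForms (i : Fin 3) : (incidentForms d i).IsHomogeneous (d i) :=
  isHomogeneous_forceZero (isHomogeneous_ofCoeffs _) _ _

/-- Substitution of the generic triple of forms with a common zero. -/
noncomputable def incidenceHom (d : Fin 3 → ℕ) :
    MvPolynomial (CoeffIndex d) ℤ →+* MvPolynomial (CoeffIndex d ⊕ (Fin 3 ⊕ Fin 3)) ℤ :=
  subst fun v => coeffs (d v.1) (incidentForms d v.1) v.2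

theorem incidenceHom_apply (P : MvPolynomial (CoeffIndex d) ℤ) :
    incidenceHom d P = evalForms P (incidentForms d) := rfl

theorem evalForms_forceZero_eq_zero {P : MvPolynomial (CoeffIndex d) ℤ}
    (hP : incidenceHom d P = 0) {f : Fin 3 → MvPolynomial (Fin 3) S}
    (hf : ∀ i, (f i).IsHomogeneous (d i)) (z l : Fin 3 → S) :
    evalForms P (fun i => forceZero (d i) (f i) z l) = 0 := by
  let φ : MvPolynomial (CoeffIndex d ⊕ (Fin 3 ⊕ Fin 3)) ℤ →+* S :=
    subst (Sum.elim (fun v => coeffs (d v.1) (f v.1) v.2) (Sum.elim z l))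
  have h := congrArg φ hP
  rw [incidenceHom_apply, map_evalForms, map_zero] at h
  simpa [incidentForms, map_forceZero, map_ofCoeffs, φ, ofCoeffs_coeffs (hf _),
    Function.comp_def] using h

theorem evalForms_eq_zero_of_incidenceHom [IsDomain S] {P : MvPolynomial (CoeffIndex d) ℤ}
    (hP : incidenceHom d P = 0) {f : Fin 3 → MvPolynomial (Fin 3) S}
    (hf : ∀ i, (f i).IsHomogeneous (d i)) (h : HasCommonZero f) : evalForms P f = 0 := by
  obtain ⟨z, hz, hzf⟩ := h
  let φ := algebraMap S (FractionRing S)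
  have hφ : Function.Injective φ := IsFractionRing.injective _ _
  obtain ⟨l, hl⟩ := exists_eval_linearForm_eq_one (z := φ ∘ z)
    fun h0 => hz (hφ.comp_left (h0.trans (by ext; simp)))
  have hforce (i) : forceZero (d i) (map φ (f i)) (φ ∘ z) l = map φ (f i) :=
    forceZero_of_eval_eq_zero (by rw [← map_eval, hzf, map_zero]) hl
  have := evalForms_forceZero_eq_zero hP (fun i => (hf i).map φ) (φ ∘ z) l
  apply hφ
  rw [map_evalForms, map_zero]
  simpa only [hforce] using this

theorem incidenceHom_macaulayDet {N : ℕ} {g : Exponents N → Fin 3 × (Fin 3 →₀ ℕ)}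
    (hg : ∀ u, (g u).2.degree + d (g u).1 = N) : incidenceHom d (macaulayDet d g) = 0 := by
  rw [incidenceHom_apply, evalForms_macaulayDet g isHomogeneous_incidentForms]
  exact det_macaulayMatrix_eq_zero hg isHomogeneous_incidentForms
    ⟨_, Function.ne_iff.mpr ⟨0, X_ne_zero _⟩, fun i => eval_forceZero _ _ _ _⟩

theorem exists_subst_ne_zero {σ : Type*} {P : MvPolynomial σ ℤ} (hP : P ≠ 0) :
    ∃ c : σ → ℂ, subst c P ≠ 0 := by
  by_contra! h
  refine hP (map_injective (Int.castRingHom ℂ) Int.cast_injective (MvPolynomial.funext fun c => ?_))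
  rw [map_zero, map_zero, eval_map]
  exact h c

/-! ### Common zeros of fewer polynomials than variables -/

section Krull

variable {σ K : Type*} [Field K]

theorem card_le_height_ker_aeval [Finite σ] [DecidableEq σ] (s : Finset σ) :
    (s.card : ℕ∞) ≤ (RingHom.ker
      (aeval fun i => if i ∈ s then 0 else X i :
        MvPolynomial σ K →ₐ[K] MvPolynomial σ K)).height := by
  let φ (s : Finset σ) : MvPolynomial σ K →ₐ[K] MvPolynomial σ K :=
    aeval fun i => if i ∈ s then 0 else X i
  have hprime (s) : (RingHom.ker (φ s)).IsPrime := RingHom.ker_isPrime _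
  induction s using Finset.induction_on with
  | empty => simp
  | insert j s hj ih =>
    have hcomp : (φ (insert j s)).comp (φ s) = φ (insert j s) := by
      ext1 i
      by_cases hi : i ∈ s <;> simp [φ, hi]
    have hlt : RingHom.ker (φ s) < RingHom.ker (φ (insert j s)) := by
      refine lt_of_le_of_ne (fun p hp => ?_) fun heq => ?_
      · rw [RingHom.mem_ker] at hp ⊢
        rw [← hcomp, AlgHom.comp_apply, hp, map_zero]
      · have : (X j : MvPolynomial σ K) ∈ RingHom.ker (φ s) := by
          rw [heq, RingHom.mem_ker]
          simp [φ]
        simp [φ, hj, X_ne_zero] at this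
    rw [Finset.card_insert_of_notMem hj, Nat.cast_add, Nat.cast_one]
    exact (add_le_add_left ih 1).trans
      (Order.add_one_le_of_lt (Ideal.height_strict_mono_of_isPrime hlt))

theorem card_le_height_vanishingIdeal_zero [Fintype σ] :
    (Fintype.card σ : ℕ∞) ≤ (vanishingIdeal K {(0 : σ → K)}).height := by
  classical
  refine (card_le_height_ker_aeval (K := K) Finset.univ).trans (Ideal.height_mono fun p hp => ?_)
  have hcomp : (aeval (0 : σ → K)).comp
      (aeval fun i => if i ∈ Finset.univ then 0 else X i : MvPolynomial σ K →ₐ[K] _) =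
        aeval (0 : σ → K) := by
    ext1 i
    simp
  rw [mem_vanishingIdeal_singleton_iff, ← hcomp, AlgHom.comp_apply, RingHom.mem_ker.mp hp, map_zero]

theorem exists_ne_zero_eval_eq_zero [Fintype σ] [IsAlgClosed K] {s : Finset (MvPolynomial σ K)}
    (hs : s.card < Fintype.card σ) (h0 : ∀ f ∈ s, eval 0 f = 0) :
    ∃ z : σ → K, z ≠ 0 ∧ ∀ f ∈ s, eval z f = 0 := by
  by_contra! h
  have hmin : vanishingIdeal K {(0 : σ → K)} ∈
      (Ideal.span (s : Set (MvPolynomial σ K))).minimalPrimes := by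
    refine ⟨⟨inferInstance, Ideal.span_le.mpr fun p hp => ?_⟩, fun q hq _ => ?_⟩
    · simpa [mem_vanishingIdeal_singleton_iff, aeval_eq_eval] using h0 p hp
    · have hrad := hq.1.radical_le_iff.mpr hq.2
      rw [← vanishingIdeal_zeroLocus_eq_radical (K := K), zeroLocus_span] at hrad
      refine le_trans (vanishingIdeal_anti_mono fun z hz => ?_) hrad
      by_contra hne
      obtain ⟨f, hf, hfz⟩ := h z hne
      exact hfz (by simpa [aeval_eq_eval] using hz f hf)
  have := card_le_height_vanishingIdeal_zero.trans
    (Ideal.height_le_card_of_mem_minimalPrimes_span_finset hmin)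
  exact hs.not_ge (by exact_mod_cast this)

end Krull

/-! ### Existence of the resultant -/

/-- The exponent of `xᵢ ^ n`. -/
noncomputable def pureExponent (i : Fin 3) (n : ℕ) : Exponents n := ⟨Finsupp.single i n, by simp⟩

/-- Macaulay's determinant of `x₀` and the last two of the generic forms. It detects common zeros of
these two forms on the line `x₀ = 0`. -/
noncomputable def macaulayLineDet (d : Fin 3 → ℕ) : MvPolynomial (CoeffIndex d) ℤ :=
  (macaulayMatrix (macaulayChoice (Function.update d 0 1) 0)
    (Function.update (genericForms d) 0 (X 0))).det

theorem evalForms_macaulayLineDet {f : Fin 3 → MvPolynomial (Fin 3) S}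
    (hf : ∀ i, (f i).IsHomogeneous (d i)) :
    evalForms (macaulayLineDet d) f = (macaulayMatrix (macaulayChoice (Function.update d 0 1) 0)
      (Function.update f 0 (X 0))).det := by
  rw [evalForms, macaulayLineDet, map_det_macaulayMatrix, map_update]
  simp only [map_subst_genericForms hf, map_X]

theorem macaulayLineDet_ne_zero (d : Fin 3 → ℕ) : macaulayLineDet d ≠ 0 := fun h0 => by
  have h := evalForms_macaulayLineDet (f := fun i => (X i ^ d i : MvPolynomial (Fin 3) ℤ))
    fun i => isHomogeneous_X_pow _ _
  have hpow : Function.update (fun i => (X i ^ d i : MvPolynomial (Fin 3) ℤ)) 0 (X 0) =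
      fun i => X i ^ Function.update d 0 1 i := by
    funext i
    fin_cases i <;> simp
  rw [h0, evalForms_zero, hpow, det_macaulayMatrix_X_pow] at h
  exact zero_ne_one h

theorem evalForms_macaulayLineDet_eq_zero [IsDomain S] {f : Fin 3 → MvPolynomial (Fin 3) S}
    (hf : ∀ i, (f i).IsHomogeneous (d i)) {z : Fin 3 → S} (hz : z ≠ 0) (hz0 : z 0 = 0)
    (hz1 : eval z (f 1) = 0) (hz2 : eval z (f 2) = 0) :
    evalForms (macaulayLineDet d) f = 0 := by
  rw [evalForms_macaulayLineDet hf]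
  refine det_macaulayMatrix_eq_zero (d := Function.update d 0 1) (degree_macaulayChoice 0)
    (fun i => ?_) ⟨z, hz, fun i => ?_⟩
  · rcases eq_or_ne i 0 with rfl | hi
    · simpa using isHomogeneous_X S 0
    · simpa [hi] using hf i
  · fin_cases i <;> simpa

theorem eval_zero_of_isHomogeneous {σ : Type*} {n : ℕ} (hn : 0 < n) {f : MvPolynomial σ S}
    (hf : f.IsHomogeneous n) : eval 0 f = 0 := by
  rw [MvPolynomial.eval_zero, constantCoeff_eq]
  exact hf.coeff_eq_zero (by simpa using hn.ne)

theorem exists_hasCommonZero_update {K : Type*} [Field K] [IsAlgClosed K] (hd : ∀ i, 0 < d i)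
    {f : Fin 3 → MvPolynomial (Fin 3) K} (hf : ∀ i, (f i).IsHomogeneous (d i))
    (h : evalForms (macaulayLineDet d) f ≠ 0) :
    ∃ a, HasCommonZero (Function.update f 0 (f 0 - C a * X 0 ^ d 0)) := by
  classical
  have h0 (i) : eval 0 (f i) = 0 := eval_zero_of_isHomogeneous (hd i) (hf i)
  obtain ⟨z, hz, hzf⟩ := exists_ne_zero_eval_eq_zero (s := {f 1, f 2})
    (Finset.card_le_two.trans_lt (by simp)) (by
      simp only [Finset.mem_insert, Finset.mem_singleton]
      rintro _ (rfl | rfl) <;> exact h0 _)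
  have hz1 : eval z (f 1) = 0 := hzf _ (by simp)
  have hz2 : eval z (f 2) = 0 := hzf _ (by simp)
  have hz0 : z 0 ≠ 0 := fun hz0 => h (evalForms_macaulayLineDet_eq_zero hf hz hz0 hz1 hz2)
  refine ⟨eval z (f 0) / z 0 ^ d 0, z, hz, fun i => ?_⟩
  fin_cases i
  · simp [div_mul_cancel₀ _ (pow_ne_zero _ hz0)]
  · simpa
  · simpa

theorem evalForms_rename_update_sub
    (s : MvPolynomial {w : CoeffIndex d // w ≠ ⟨0, pureExponent 0 (d 0)⟩} ℤ)
    (f : Fin 3 → MvPolynomial (Fin 3) S) (a : S) :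
    evalForms (rename Subtype.val s) (Function.update f 0 (f 0 - C a * X 0 ^ d 0)) =
      evalForms (rename Subtype.val s) f := by
  rw [evalForms, evalForms, subst_rename, subst_rename]
  congr 2
  funext ⟨⟨i, u⟩, hv⟩
  rcases eq_or_ne i 0 with rfl | hi
  · have hu : Finsupp.single 0 (d 0) ≠ u.1 := fun hu => hv (by
      rw [show u = pureExponent 0 (d 0) from Subtype.ext hu.symm])
    simp [coeffs, X_pow_eq_monomial, C_mul_monomial, coeff_monomial, hu]
  · simp [hi]

theorem exists_evalForms_ne_zero {P : MvPolynomial (CoeffIndex d) ℤ} (hP : P ≠ 0) :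
    ∃ f : Fin 3 → MvPolynomial (Fin 3) ℂ, (∀ i, (f i).IsHomogeneous (d i)) ∧
      evalForms P f ≠ 0 := by
  obtain ⟨c, hc⟩ := exists_subst_ne_zero hP
  exact ⟨fun i => ofCoeffs fun u => c ⟨i, u⟩, fun i => isHomogeneous_ofCoeffs _, by
    simpa [evalForms] using hc⟩

/-- The coefficient of `x₀ ^ (d 0)` in the first form can be chosen so as to create a common zero,
whatever the other coefficients are. -/
theorem eq_zero_of_incidenceHom_rename (hd : ∀ i, 0 < d i)
    {s : MvPolynomial {w : CoeffIndex d // w ≠ ⟨0, pureExponent 0 (d 0)⟩} ℤ}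
    (h : incidenceHom d (rename Subtype.val s) = 0) : s = 0 := by
  by_contra hs
  have hs' := (map_ne_zero_iff _ (rename_injective _ Subtype.val_injective)).mpr hs
  obtain ⟨f, hf, hne⟩ := exists_evalForms_ne_zero (mul_ne_zero hs' (macaulayLineDet_ne_zero d))
  rw [evalForms_mul] at hne
  obtain ⟨a, ha⟩ := exists_hasCommonZero_update hd hf (right_ne_zero_of_mul hne)
  refine left_ne_zero_of_mul hne ?_
  rw [← evalForms_rename_update_sub s f a]
  exact evalForms_eq_zero_of_incidenceHom h
    (isHomogeneous_update hf ((hf 0).sub ((isHomogeneous_X_pow _ _).C_mul _))) ha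

theorem exists_prime_ker_incidenceHom_eq_span (hd : ∀ i, 0 < d i) :
    ∃ R : MvPolynomial (CoeffIndex d) ℤ, Prime R ∧
      RingHom.ker (incidenceHom d) = Ideal.span {R} ∧
      evalForms R (fun i => (X i ^ d i : MvPolynomial (Fin 3) ℤ)) = 1 := by
  have hker : macaulayDet d (macaulayChoice d 0) ∈ RingHom.ker (incidenceHom d) :=
    incidenceHom_macaulayDet (degree_macaulayChoice 0)
  have hone : evalForms (macaulayDet d (macaulayChoice d 0))
      (fun i => (X i ^ d i : MvPolynomial (Fin 3) ℤ)) = 1 := by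
    rw [evalForms_macaulayDet _ fun i => isHomogeneous_X_pow _ _, det_macaulayMatrix_X_pow]
  have hprime : (RingHom.ker (incidenceHom d)).IsPrime := RingHom.ker_isPrime _
  obtain ⟨R, hR, hspan⟩ := exists_prime_eq_span_singleton_of_rename
    ((Submodule.ne_bot_iff _).mpr ⟨_, hker, fun h0 => by simp [h0] at hone⟩)
    ⟨0, pureExponent 0 (d 0)⟩ fun s hs => eq_zero_of_incidenceHom_rename hd hs
  obtain ⟨Q, hQ⟩ : R ∣ macaulayDet d (macaulayChoice d 0) := by
    rwa [← Ideal.mem_span_singleton, ← hspan]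
  rw [hQ, evalForms_mul] at hone
  rcases Int.eq_one_or_neg_one_of_mul_eq_one hone with h | h
  · exact ⟨R, hR, hspan, h⟩
  · refine ⟨-R, hR.neg, by rw [hspan, Ideal.span_singleton_neg], ?_⟩
    simpa [evalForms, neg_eq_iff_eq_neg] using h

open scoped Classical in
/-- The resultant of three ternary forms of degrees `d 0, d 1, d 2`, as a polynomial in their
coefficients: the generator of the ideal of integer polynomials vanishing on triples with a common
zero that takes the value `1` at `(x₀ ^ d 0, x₁ ^ d 1, x₂ ^ d 2)`. It is the junk value `1` unless
all degrees are positive. -/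
noncomputable def resultant (d : Fin 3 → ℕ) : MvPolynomial (CoeffIndex d) ℤ :=
  if hd : ∀ i, 0 < d i then (exists_prime_ker_incidenceHom_eq_span hd).choose else 1

/-- The value of the resultant at three ternary forms of degrees `d 0, d 1, d 2`. -/
noncomputable def res (d : Fin 3 → ℕ) (f : Fin 3 → MvPolynomial (Fin 3) S) : S :=
  evalForms (resultant d) f

theorem resultant_spec (hd : ∀ i, 0 < d i) : Prime (resultant d) ∧
    RingHom.ker (incidenceHom d) = Ideal.span {resultant d} ∧
    evalForms (resultant d) (fun i => (X i ^ d i : MvPolynomial (Fin 3) ℤ)) = 1 := by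
  rw [resultant, dif_pos hd]
  exact (exists_prime_ker_incidenceHom_eq_span hd).choose_spec

theorem prime_resultant (hd : ∀ i, 0 < d i) : Prime (resultant d) := (resultant_spec hd).1

theorem ker_incidenceHom (hd : ∀ i, 0 < d i) :
    RingHom.ker (incidenceHom d) = Ideal.span {resultant d} := (resultant_spec hd).2.1

theorem map_res (φ : S →+* T) (f : Fin 3 → MvPolynomial (Fin 3) S) :
    φ (res d f) = res d fun i => map φ (f i) := map_evalForms φ _ f

theorem res_genericForms (d : Fin 3 → ℕ) : res d (genericForms d) = resultant d :=
  evalForms_genericForms _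

theorem res_X_pow (hd : ∀ i, 0 < d i) :
    res d (fun i => (X i ^ d i : MvPolynomial (Fin 3) S)) = 1 := by
  have h := map_res (d := d) (Int.castRingHom S) fun i => X i ^ d i
  rw [res, (resultant_spec hd).2.2] at h
  simpa using h.symm

theorem res_eq_zero_of_hasCommonZero [IsDomain S] (hd : ∀ i, 0 < d i)
    {f : Fin 3 → MvPolynomial (Fin 3) S} (hf : ∀ i, (f i).IsHomogeneous (d i))
    (h : HasCommonZero f) : res d f = 0 := by
  have : resultant d ∈ RingHom.ker (incidenceHom d) := by
    rw [ker_incidenceHom hd]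
    exact Ideal.mem_span_singleton_self _
  exact evalForms_eq_zero_of_incidenceHom this hf h

theorem resultant_dvd_macaulayDet (hd : ∀ i, 0 < d i) {N : ℕ}
    {g : Exponents N → Fin 3 × (Fin 3 →₀ ℕ)} (hg : ∀ u, (g u).2.degree + d (g u).1 = N) :
    resultant d ∣ macaulayDet d g := by
  rw [← Ideal.mem_span_singleton, ← ker_incidenceHom hd]
  exact incidenceHom_macaulayDet hg

theorem res_eq_zero_iff {K : Type*} [Field K] [IsAlgClosed K] (hd : ∀ i, 0 < d i)
    {f : Fin 3 → MvPolynomial (Fin 3) K} (hf : ∀ i, (f i).IsHomogeneous (d i)) :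
    res d f = 0 ↔ HasCommonZero f := by
  refine ⟨fun h => ?_, res_eq_zero_of_hasCommonZero hd hf⟩
  by_contra hne
  obtain ⟨N, g, hg, hdet⟩ := exists_det_macaulayMatrix_ne_zero hf hne
  obtain ⟨E, hE⟩ := resultant_dvd_macaulayDet hd hg
  rw [← evalForms_macaulayDet g hf, hE, evalForms_mul, ← res, h, zero_mul] at hdet
  exact hdet rfl

/-! ### Polynomials determined by their complex zeros -/

theorem not_dvd_C_of_subst_eq_zero {σ : Type*} [CharZero S] {P : MvPolynomial σ ℤ} {c : σ → S}
    (hc : subst c P = 0) {N : ℤ} (hN : N ≠ 0) : ¬ P ∣ C N := by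
  rintro ⟨E, hE⟩
  have := congrArg (subst c) hE
  rw [map_mul, hc, zero_mul, subst, eval₂Hom_C] at this
  simp [hN] at this

section Nullstellensatz

variable {σ : Type*} [Finite σ] {P Q : MvPolynomial σ ℤ}

theorem exists_dvd_C_mul_pow (h : ∀ c : σ → ℂ, subst c P = 0 → subst c Q = 0) :
    ∃ N : ℤ, N ≠ 0 ∧ ∃ n : ℕ, P ∣ C N * Q ^ n := by
  let φ : MvPolynomial σ ℤ →+* MvPolynomial σ ℚ := map (Int.castRingHom ℚ)
  have hφ : Function.Injective φ := map_injective _ Int.cast_injective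
  have haeval (c : σ → ℂ) (p) : aeval c (φ p) = subst c p := by
    rw [aeval_def, eval₂_map, subst]
    exact congrArg (fun ψ => eval₂ ψ c p) (RingHom.ext_int _ _)
  obtain ⟨n, hn⟩ : φ Q ∈ (Ideal.span {φ P}).radical := by
    rw [← vanishingIdeal_zeroLocus_eq_radical (K := ℂ), zeroLocus_span]
    intro c hc
    have hc' := hc (φ P) rfl
    rw [haeval] at hc' ⊢
    exact h c hc'
  obtain ⟨E, hE⟩ := Ideal.mem_span_singleton.mp hn
  let := algebraMvPolynomial (R := ℤ) (S := ℚ) (σ := σ)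
  obtain ⟨⟨E', s⟩, hE'⟩ :=
    IsLocalization.surj (Submonoid.map (C (σ := σ)) (nonZeroDivisors ℤ)) E
  obtain ⟨N, hN, hs⟩ := Submonoid.mem_map.mp s.2
  refine ⟨N, nonZeroDivisors.ne_zero hN, n, E', hφ ?_⟩
  have hE'φ : E * φ s = φ E' := hE'
  rw [hs, map_mul, map_mul, map_pow, hE, ← hE'φ]
  ring

theorem dvd_of_forall_subst_eq_zero (hP : Prime P) {c : σ → ℂ} (hc : subst c P = 0)
    (h : ∀ c : σ → ℂ, subst c P = 0 → subst c Q = 0) : P ∣ Q := by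
  obtain ⟨N, hN, n, hdvd⟩ := exists_dvd_C_mul_pow h
  exact hP.dvd_of_dvd_pow ((hP.dvd_or_dvd hdvd).resolve_left (not_dvd_C_of_subst_eq_zero hc hN))

theorem exists_eq_C_mul_pow (hQ : Prime Q)
    (h : ∀ c : σ → ℂ, subst c P = 0 → subst c Q = 0) :
    ∃ (a : ℤ) (n : ℕ), P = C a * Q ^ n := by
  obtain ⟨N, hN, n, hdvd⟩ := exists_dvd_C_mul_pow h
  obtain ⟨A, B, hA, hB, rfl⟩ := exists_dvd_and_dvd_of_dvd_mul hdvd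
  obtain ⟨a, -, rfl⟩ := (dvd_C_iff_exists hN).mp hA
  obtain ⟨m, -, u, hu⟩ := (dvd_prime_pow hQ n).mp hB
  obtain ⟨b, -, hb⟩ : ∃ b : ℤ, b ∣ 1 ∧ (↑u⁻¹ : MvPolynomial σ ℤ) = C b :=
    (dvd_C_iff_exists one_ne_zero).mp (u⁻¹).isUnit.dvd
  refine ⟨a * b, m, ?_⟩
  rw [C_mul, mul_assoc, ← hb, ← hu, mul_comm _ (B * _), Units.mul_inv_cancel_right]

end Nullstellensatz

/-! ### Degrees of the resultant in the coefficients of each form -/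

theorem exists_eq_C_mul_X_pow_of_dvd [IsDomain S] {r : Polynomial S} {a : S} {m : ℕ} (ha : a ≠ 0)
    (h : r ∣ Polynomial.C a * Polynomial.X ^ m) :
    ∃ j ≤ m, r = Polynomial.C (r.eval 1) * Polynomial.X ^ j := by
  obtain ⟨s, hs⟩ := h
  obtain ⟨j, l, b, c, hjl, hbc, rfl, -⟩ := mul_eq_mul_prime_pow Polynomial.prime_X hs.symm
  have hne : b * c ≠ 0 := hbc ▸ Polynomial.C_ne_zero.mpr ha
  have hdeg : b.natDegree + c.natDegree = 0 := by
    rw [← Polynomial.natDegree_mul (left_ne_zero_of_mul hne) (right_ne_zero_of_mul hne), ← hbc,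
      Polynomial.natDegree_C]
  obtain ⟨b, rfl⟩ := Polynomial.natDegree_eq_zero.mp (Nat.eq_zero_of_add_eq_zero_right hdeg)
  exact ⟨j, by lia, by simp⟩

theorem macaulayDet_macaulayChoice_ne_zero (k : Fin 3) :
    macaulayDet d (macaulayChoice d k) ≠ 0 := fun h => by
  have hone := evalForms_macaulayDet (macaulayChoice d k)
    (f := fun i => (X i ^ d i : MvPolynomial (Fin 3) ℤ)) fun i => isHomogeneous_X_pow _ _
  rw [det_macaulayMatrix_X_pow, h, evalForms_zero] at hone
  exact zero_ne_one hone

/-- The generic forms, with an additional indeterminate that scales the form `k`. -/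
noncomputable def scaledGenericForms (d : Fin 3 → ℕ) (k : Fin 3) :
    Fin 3 → MvPolynomial (Fin 3) (Polynomial (MvPolynomial (CoeffIndex d) ℤ)) :=
  let F i := map Polynomial.C (genericForms d i)
  Function.update F k (C Polynomial.X * F k)

theorem map_scaledGenericForms (φ : Polynomial (MvPolynomial (CoeffIndex d) ℤ) →+* S) (k : Fin 3) :
    (fun i => map φ (scaledGenericForms d k i)) =
      Function.update (fun i => map (φ.comp Polynomial.C) (genericForms d i)) k
        (C (φ Polynomial.X) * map (φ.comp Polynomial.C) (genericForms d k)) := by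
  simp only [scaledGenericForms, map_update, map_map, map_mul, map_C]

theorem evalRingHom_comp_C (t : S) : (Polynomial.evalRingHom t).comp Polynomial.C = RingHom.id S :=
  RingHom.ext fun _ => Polynomial.eval_C

theorem exists_res_scaledGenericForms (hd : ∀ i, 0 < d i) (k : Fin 3) :
    ∃ j ≤ blockDegree d k, res d (scaledGenericForms d k) =
      Polynomial.C (resultant d) * Polynomial.X ^ j := by
  set D := macaulayDet d (macaulayChoice d k)
  have hF (i) : (map Polynomial.C (genericForms d i)).IsHomogeneous (d i) :=
    (isHomogeneous_genericForms d i).map (Polynomial.C (R := MvPolynomial (CoeffIndex d) ℤ))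
  have hD : evalForms D (scaledGenericForms d k) = Polynomial.C D *
      Polynomial.X ^ (Finset.univ.filter fun u => (macaulayChoice d k u).1 = k).card := by
    rw [scaledGenericForms, evalForms_macaulayDet _
      (isHomogeneous_update hF ((hF k).C_mul _)), det_macaulayMatrix_update_C_mul,
      ← evalForms_macaulayDet _ hF, ← map_evalForms, evalForms_genericForms, mul_comm]
  have hdvd : res d (scaledGenericForms d k) ∣ evalForms D (scaledGenericForms d k) := by
    obtain ⟨E, hE⟩ := resultant_dvd_macaulayDet hd (degree_macaulayChoice k)
    exact ⟨evalForms E (scaledGenericForms d k), by rw [res, ← evalForms_mul, ← hE]⟩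
  obtain ⟨j, hj, hr⟩ :=
    exists_eq_C_mul_X_pow_of_dvd (macaulayDet_macaulayChoice_ne_zero k) (hD ▸ hdvd)
  have hone : (res d (scaledGenericForms d k)).eval 1 = resultant d := by
    rw [← Polynomial.coe_evalRingHom, map_res, map_scaledGenericForms, evalRingHom_comp_C]
    simp [MvPolynomial.map_id, res_genericForms]
  exact ⟨j, hj.trans (card_macaulayChoice_eq_le k), hone ▸ hr⟩

theorem res_update_C_mul_of_res_scaledGenericForms {k : Fin 3} {j : ℕ}
    (hj : res d (scaledGenericForms d k) = Polynomial.C (resultant d) * Polynomial.X ^ j) (c : S)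
    {f : Fin 3 → MvPolynomial (Fin 3) S} (hf : ∀ i, (f i).IsHomogeneous (d i)) :
    res d (Function.update f k (C c * f k)) = c ^ j * res d f := by
  let φ := subst fun v : CoeffIndex d => coeffs (d v.1) (f v.1) v.2
  have h := congrArg (Polynomial.eval₂RingHom φ c) hj
  rw [map_res, map_scaledGenericForms, Polynomial.eval₂RingHom_comp_C] at h
  simp only [φ, map_subst_genericForms hf, map_mul, map_pow, Polynomial.coe_eval₂RingHom,
    Polynomial.eval₂_X, Polynomial.eval₂_C] at h
  rw [h, mul_comm]
  rfl

/-- The resultant along a line in the space of forms `k`, as a polynomial in the parameter. -/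
noncomputable def resLine (d : Fin 3 → ℕ) (f : Fin 3 → MvPolynomial (Fin 3) S) (k : Fin 3)
    (g : MvPolynomial (Fin 3) S) : Polynomial S :=
  res d (Function.update (fun i => map Polynomial.C (f i)) k
    (map Polynomial.C (f k) + C Polynomial.X * map Polynomial.C g))

theorem eval_resLine (f : Fin 3 → MvPolynomial (Fin 3) S) (k : Fin 3)
    (g : MvPolynomial (Fin 3) S) (t : S) :
    (resLine d f k g).eval t = res d (Function.update f k (f k + C t * g)) := by
  rw [resLine, ← Polynomial.coe_evalRingHom, map_res, map_update]
  simp [map_map, evalRingHom_comp_C, MvPolynomial.map_id]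

section Degree

variable {K : Type*} [Field K] {f : Fin 3 → MvPolynomial (Fin 3) K} {k : Fin 3}
  {g : MvPolynomial (Fin 3) K} {j : ℕ}

theorem pow_mul_eval_resLine_inv
    (hj : ∀ (c : K) (f : Fin 3 → MvPolynomial (Fin 3) K), (∀ i, (f i).IsHomogeneous (d i)) →
      res d (Function.update f k (C c * f k)) = c ^ j * res d f)
    (hf : ∀ i, (f i).IsHomogeneous (d i)) (hg : g.IsHomogeneous (d k)) {t : K} (ht : t ≠ 0) :
    t ^ j * (resLine d f k g).eval t⁻¹ = (resLine d (Function.update f k g) k (f k)).eval t := by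
  rw [eval_resLine, eval_resLine, ← hj t _ (isHomogeneous_update hf ((hf k).add (hg.C_mul _)))]
  simp only [Function.update_self, Function.update_idem, mul_add, ← mul_assoc, ← C_mul,
    mul_inv_cancel₀ ht, C_1, one_mul, add_comm]

theorem natDegree_resLine_le [Infinite K]
    (hj : ∀ (c : K) (f : Fin 3 → MvPolynomial (Fin 3) K), (∀ i, (f i).IsHomogeneous (d i)) →
      res d (Function.update f k (C c * f k)) = c ^ j * res d f)
    (hf : ∀ i, (f i).IsHomogeneous (d i)) (hg : g.IsHomogeneous (d k)) :
    (resLine d f k g).natDegree ≤ j := by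
  by_contra! hlt
  set q := resLine d f k g with hq
  have heval (t : K) (ht : t ≠ 0) : q.reverse.eval t =
      (Polynomial.X ^ (q.natDegree - j) * resLine d (Function.update f k g) k (f k)).eval t := by
    let := invertibleOfNonzero (inv_ne_zero ht)
    have hrev := Polynomial.eval₂_reverse_mul_pow (RingHom.id K) t⁻¹ q
    simp only [invOf_eq_inv, inv_inv, Polynomial.eval₂_id] at hrev
    rw [Polynomial.eval_mul, Polynomial.eval_pow, Polynomial.eval_X,
      ← pow_mul_eval_resLine_inv hj hf hg ht, ← hq, ← hrev, ← mul_assoc, ← pow_add,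
      Nat.sub_add_cancel hlt.le, mul_left_comm, ← mul_pow, mul_inv_cancel₀ ht, one_pow, mul_one]
  have hreverse := Polynomial.eq_of_infinite_eval_eq _ _
    ((Set.finite_singleton (0 : K)).infinite_compl.mono heval)
  have hlead := congrArg (Polynomial.eval 0) hreverse
  rw [Polynomial.eval_mul, Polynomial.eval_pow, Polynomial.eval_X,
    zero_pow (Nat.sub_ne_zero_of_lt hlt), zero_mul, ← Polynomial.coeff_zero_eq_eval_zero,
    Polynomial.coeff_zero_reverse, Polynomial.leadingCoeff_eq_zero] at hlead
  simp [hlead] at hlt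

end Degree

theorem eval_smul_of_isHomogeneous {σ : Type*} {n : ℕ} {f : MvPolynomial σ S}
    (hf : f.IsHomogeneous n) (a : S) (z : σ → S) : eval (a • z) f = a ^ n * eval z f := by
  simp only [eval_eq, Finset.mul_sum, Pi.smul_apply, smul_eq_mul, mul_pow, Finset.prod_mul_distrib,
    Finset.prod_pow_eq_pow_sum]
  refine Finset.sum_congr rfl fun u hu => ?_
  have hdeg : u.degree = n := by
    rw [Finsupp.degree_eq_weight_one]
    exact hf (mem_support_iff.mp hu)
  rw [← Finsupp.degree_apply, hdeg, mul_left_comm]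

/-- The forms `xᵢ ^ dᵢ - xₖ ^ dᵢ`. Up to scaling, the common zeros of those with `i ≠ k` are known,
and there are `blockDegree d k` of them. -/
noncomputable def unityForms (d : Fin 3 → ℕ) (k i : Fin 3) : MvPolynomial (Fin 3) ℂ :=
  X i ^ d i - X k ^ d i

/-- The common zeros `z` with `z k = 1` of the forms `xᵢ ^ dᵢ - xₖ ^ dᵢ`. -/
noncomputable def unityPoints (d : Fin 3 → ℕ) (k : Fin 3) : Finset (Fin 3 → ℂ) :=
  Fintype.piFinset fun i => if i = k then {1} else Polynomial.nthRootsFinset (d i) (1 : ℂ)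

theorem isHomogeneous_unityForms (d : Fin 3 → ℕ) (k i : Fin 3) :
    (unityForms d k i).IsHomogeneous (d i) :=
  (isHomogeneous_X_pow _ _).sub (isHomogeneous_X_pow _ _)

section UnityForms

variable {k : Fin 3} {z : Fin 3 → ℂ} {g : MvPolynomial (Fin 3) ℂ}

theorem mem_unityPoints (hd : ∀ i, 0 < d i) :
    z ∈ unityPoints d k ↔ z k = 1 ∧ ∀ i, i ≠ k → z i ^ d i = 1 := by
  rw [unityPoints, Fintype.mem_piFinset]
  refine ⟨fun h => ⟨by simpa using h k, fun i hi => ?_⟩, fun h i => ?_⟩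
  · simpa [hi, Polynomial.mem_nthRootsFinset (hd i)] using h i
  · by_cases hi : i = k
    · simp [hi, h.1]
    · simpa [hi, Polynomial.mem_nthRootsFinset (hd i)] using h.2 i hi

theorem card_unityPoints (hd : ∀ i, 0 < d i) (k : Fin 3) :
    (unityPoints d k).card = blockDegree d k := by
  rw [unityPoints, Fintype.card_piFinset, blockDegree]
  refine Finset.prod_congr rfl fun i _ => ?_
  split_ifs
  · simp
  · exact (Complex.isPrimitiveRoot_exp _ (hd i).ne').card_nthRootsFinset

theorem eval_unityForms_of_mem (hd : ∀ i, 0 < d i) (hz : z ∈ unityPoints d k) (i : Fin 3) :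
    eval z (unityForms d k i) = 0 := by
  rw [mem_unityPoints hd] at hz
  rcases eq_or_ne i k with rfl | hi
  · simp [unityForms]
  · simp [unityForms, hz.1, hz.2 i hi]

theorem exists_mem_unityPoints (hd : ∀ i, 0 < d i) (hz : z ≠ 0)
    (h : ∀ i, i ≠ k → eval z (unityForms d k i) = 0) :
    ∃ a : ℂ, a ≠ 0 ∧ ∃ w ∈ unityPoints d k, z = a • w := by
  have hpow (i) (hi : i ≠ k) : z i ^ d i = z k ^ d i := by
    simpa [unityForms, sub_eq_zero] using h i hi
  have hk : z k ≠ 0 := fun hk => hz <| funext fun i => by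
    rcases eq_or_ne i k with rfl | hi
    · exact hk
    · exact (pow_eq_zero_iff (hd i).ne').mp (by rw [hpow i hi, hk, zero_pow (hd i).ne'])
  refine ⟨z k, hk, (z k)⁻¹ • z, (mem_unityPoints hd).mpr ⟨inv_mul_cancel₀ hk, fun i hi => ?_⟩,
    (smul_inv_smul₀ hk z).symm⟩
  rw [Pi.smul_apply, smul_eq_mul, mul_pow, hpow i hi, ← mul_pow, inv_mul_cancel₀ hk, one_pow]

theorem eval_resLine_unityForms_eq_zero_iff (hd : ∀ i, 0 < d i) (hg : g.IsHomogeneous (d k))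
    (t : ℂ) : (resLine d (Function.update (unityForms d k) k g) k (X k ^ d k)).eval t = 0 ↔
      ∃ w ∈ unityPoints d k, t = -eval w g := by
  have hline : (g + C t * X k ^ d k).IsHomogeneous (d k) :=
    hg.add ((isHomogeneous_X_pow _ _).C_mul _)
  have heval {w} (hw : w ∈ unityPoints d k) : eval w (g + C t * X k ^ d k) = eval w g + t := by
    simp [((mem_unityPoints hd).mp hw).1]
  rw [eval_resLine, Function.update_idem, Function.update_self,
    res_eq_zero_iff hd (isHomogeneous_update (isHomogeneous_unityForms d k) hline)]
  constructor
  · rintro ⟨z, hz, hzf⟩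
    obtain ⟨a, ha, w, hw, rfl⟩ := exists_mem_unityPoints hd hz fun i hi => by
      have hi0 := hzf i
      rwa [Function.update_of_ne hi] at hi0
    have hk := hzf k
    rw [Function.update_self, eval_smul_of_isHomogeneous hline, heval hw] at hk
    exact ⟨w, hw, eq_neg_of_add_eq_zero_right
      ((mul_eq_zero.mp hk).resolve_left (pow_ne_zero _ ha))⟩
  · rintro ⟨w, hw, rfl⟩
    refine ⟨w, Function.ne_iff.mpr ⟨k, by simp [((mem_unityPoints hd).mp hw).1]⟩, fun i => ?_⟩
    rcases eq_or_ne i k with rfl | hi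
    · rw [Function.update_self, heval hw, add_neg_cancel]
    · rw [Function.update_of_ne hi, eval_unityForms_of_mem hd hw]

theorem resLine_unityForms_ne_zero (hd : ∀ i, 0 < d i) (hg : g.IsHomogeneous (d k)) :
    resLine d (Function.update (unityForms d k) k g) k (X k ^ d k) ≠ 0 := by
  classical
  intro h0
  obtain ⟨t, ht⟩ := Infinite.exists_notMem_finset ((unityPoints d k).image fun w => -eval w g)
  obtain ⟨w, hw, rfl⟩ := (eval_resLine_unityForms_eq_zero_iff hd hg t).mp (by simp [h0])
  exact ht (Finset.mem_image_of_mem _ hw)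

theorem blockDegree_le_card_roots (hd : ∀ i, 0 < d i) (hg : g.IsHomogeneous (d k))
    (hinj : Set.InjOn (fun w => eval w g) (unityPoints d k)) :
    blockDegree d k ≤
      (resLine d (Function.update (unityForms d k) k g) k (X k ^ d k)).roots.toFinset.card := by
  rw [← card_unityPoints hd k]
  refine Finset.card_le_card_of_injOn (fun w => -eval w g) (fun w hw => ?_)
    fun w hw w' hw' he => hinj hw hw' (neg_injective he)
  rw [Finset.mem_coe, Multiset.mem_toFinset,
    Polynomial.mem_roots (resLine_unityForms_ne_zero hd hg)]
  exact (eval_resLine_unityForms_eq_zero_iff hd hg _).mpr ⟨w, hw, rfl⟩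

end UnityForms

theorem exists_linearForm_injOn {σ K : Type*} [Fintype σ] [Field K] [Infinite K]
    (Z : Finset (σ → K)) :
    ∃ l : σ → K, (∀ i, l i ≠ 0) ∧ Set.InjOn (fun z => eval z (linearForm l)) Z := by
  classical
  let v : σ ⊕ {p : Z × Z // p.1 ≠ p.2} → σ → K :=
    Sum.elim (fun i => Pi.single i 1) fun p => p.1.1.1 - p.1.2.1
  obtain ⟨φ, hφ⟩ := Module.exists_dual_forall_apply_ne_zero (K := K) v (by
    rintro (i | ⟨p, hp⟩)
    · simp [v]
    · exact sub_ne_zero.mpr fun he => hp (Subtype.ext he))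
  let l i := φ (Pi.single i 1)
  have heval (z : σ → K) : eval z (linearForm l) = φ z := by
    rw [eval_linearForm]
    conv_rhs => rw [pi_eq_sum_univ' z, map_sum]
    simp [l, mul_comm]
  refine ⟨l, fun i => hφ (.inl i), fun z hz w hw he => ?_⟩
  by_contra hne
  refine hφ (.inr ⟨(⟨z, hz⟩, ⟨w, hw⟩), by simpa using hne⟩) ?_
  simp only [heval] at he
  simp [v, he]

theorem res_scaledGenericForms (hd : ∀ i, 0 < d i) (k : Fin 3) :
    res d (scaledGenericForms d k) =
      Polynomial.C (resultant d) * Polynomial.X ^ blockDegree d k := by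
  obtain ⟨j, hj, hres⟩ := exists_res_scaledGenericForms hd k
  obtain ⟨l, -, hl⟩ := exists_linearForm_injOn (unityPoints d k)
  have hg : (linearForm l * X k ^ (d k - 1)).IsHomogeneous (d k) := by
    simpa [Nat.add_sub_cancel' (hd k)] using
      (isHomogeneous_linearForm l).mul (isHomogeneous_X_pow k (d k - 1))
  have hinj : Set.InjOn (fun w => eval w (linearForm l * X k ^ (d k - 1))) (unityPoints d k) :=
    hl.congr fun w hw => by simp [((mem_unityPoints hd).mp hw).1]
  have hroots := blockDegree_le_card_roots hd hg hinj
  have hdeg := natDegree_resLine_le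
    (fun c f hf => res_update_C_mul_of_res_scaledGenericForms hres c hf)
    (isHomogeneous_update (isHomogeneous_unityForms d k) hg) (isHomogeneous_X_pow k (d k))
  rwa [← hj.antisymm
    (hroots.trans ((Multiset.toFinset_card_le _).trans ((Polynomial.card_roots' _).trans hdeg)))]

theorem res_update_C_mul (hd : ∀ i, 0 < d i) (k : Fin 3) (c : S)
    {f : Fin 3 → MvPolynomial (Fin 3) S} (hf : ∀ i, (f i).IsHomogeneous (d i)) :
    res d (Function.update f k (C c * f k)) = c ^ blockDegree d k * res d f :=
  res_update_C_mul_of_res_scaledGenericForms (res_scaledGenericForms hd k) c hf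

theorem nodup_roots_resLine_unityForms (hd : ∀ i, 0 < d i) {k : Fin 3}
    {g : MvPolynomial (Fin 3) ℂ} (hg : g.IsHomogeneous (d k))
    (hinj : Set.InjOn (fun w => eval w g) (unityPoints d k)) :
    (resLine d (Function.update (unityForms d k) k g) k (X k ^ d k)).roots.Nodup := by
  have hroots := blockDegree_le_card_roots hd hg hinj
  have hdeg := natDegree_resLine_le (fun c f hf => res_update_C_mul hd k c hf)
    (isHomogeneous_update (isHomogeneous_unityForms d k) hg) (isHomogeneous_X_pow k (d k))
  rw [← Multiset.toFinset_card_eq_card_iff_nodup]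
  exact (Multiset.toFinset_card_le _).antisymm
    ((Polynomial.card_roots' _).trans (hdeg.trans hroots))

/-! ### Invariance under addition of multiples of the other forms -/

theorem hasCommonZero_update_add_iff {σ ι : Type*} [DecidableEq ι] {f : ι → MvPolynomial σ S}
    {k : ι} {g : MvPolynomial σ S} (hg : ∀ z, (∀ i, i ≠ k → eval z (f i) = 0) → eval z g = 0) :
    HasCommonZero (Function.update f k (f k + g)) ↔ HasCommonZero f := by
  refine exists_congr fun z => and_congr_right fun _ => ?_
  have hsplit (f : ι → MvPolynomial σ S) : (∀ i, eval z (f i) = 0) ↔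
      (∀ i, i ≠ k → eval z (f i) = 0) ∧ eval z (f k) = 0 :=
    ⟨fun h => ⟨fun i _ => h i, h k⟩, fun h i => (eq_or_ne i k).elim (· ▸ h.2) (h.1 i)⟩
  rw [hsplit, hsplit f]
  simp +contextual [hg z]

theorem res_update_add_of_isAlgClosed {K : Type*} [Field K] [IsAlgClosed K] (hd : ∀ i, 0 < d i)
    {f : Fin 3 → MvPolynomial (Fin 3) K} (hf : ∀ i, (f i).IsHomogeneous (d i)) {k : Fin 3}
    {g : MvPolynomial (Fin 3) K} (hg : g.IsHomogeneous (d k))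
    (h : ∀ z, (∀ i, i ≠ k → eval z (f i) = 0) → eval z g = 0) :
    res d (Function.update f k (f k + g)) = res d f := by
  have hzero (t) : (resLine d f k g).eval t = 0 ↔ res d f = 0 := by
    rw [eval_resLine, res_eq_zero_iff hd hf,
      res_eq_zero_iff hd (isHomogeneous_update hf ((hf k).add (hg.C_mul t)))]
    exact hasCommonZero_update_add_iff fun z hz => by simp [h z hz]
  have hval0 : (resLine d f k g).eval 0 = res d f := by simp [eval_resLine]
  have hval1 : (resLine d f k g).eval 1 = res d (Function.update f k (f k + g)) := by
    simp [eval_resLine]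
  rw [← hval1]
  rcases eq_or_ne (res d f) 0 with hres | hres
  · rw [hres, hzero, hres]
  · have hdeg : (resLine d f k g).degree = 0 := by
      by_contra hne
      obtain ⟨t, ht⟩ := IsAlgClosed.exists_root _ hne
      exact hres ((hzero t).mp ht)
    rw [← hval0, Polynomial.eq_C_of_degree_eq_zero hdeg, Polynomial.eval_C, Polynomial.eval_C]

theorem res_update_add [IsDomain S] (hd : ∀ i, 0 < d i)
    {f : Fin 3 → MvPolynomial (Fin 3) S} (hf : ∀ i, (f i).IsHomogeneous (d i)) {k : Fin 3}
    {g : MvPolynomial (Fin 3) S} (hg : g.IsHomogeneous (d k))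
    (hspan : g ∈ Ideal.span (f '' {k}ᶜ)) :
    res d (Function.update f k (f k + g)) = res d f := by
  let φ : S →+* AlgebraicClosure (FractionRing S) :=
    (algebraMap (FractionRing S) _).comp (algebraMap S _)
  have hφ : Function.Injective φ :=
    (algebraMap (FractionRing S) _).injective.comp (IsFractionRing.injective S _)
  apply hφ
  rw [map_res, map_res, map_update, map_add]
  refine res_update_add_of_isAlgClosed hd (fun i => (hf i).map φ) (hg.map φ) fun z hz => ?_
  suffices hle : Ideal.span (f '' {k}ᶜ) ≤ RingHom.ker ((eval z).comp (map φ)) from hle hspan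
  rw [Ideal.span_le]
  rintro _ ⟨i, hi, rfl⟩
  exact hz i hi

/-! ### Multiplicativity of the resultant -/

theorem prime_rename_of_injective {σ τ : Type*} {ι : σ → τ} (hι : Function.Injective ι)
    {P : MvPolynomial σ ℤ} (hP : Prime P) : Prime (rename ι P) := by
  let e := Equiv.ofInjective ι hι
  have he : Prime (rename e P) := (MulEquiv.prime_iff (renameEquiv ℤ e).toMulEquiv).mpr hP
  have hrename := (prime_rename_iff (Set.range ι)).mpr he
  rwa [rename_rename] at hrename

theorem res_C_mul (hd : ∀ i, 0 < d i) (c : Fin 3 → S)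
    {f : Fin 3 → MvPolynomial (Fin 3) S} (hf : ∀ i, (f i).IsHomogeneous (d i)) :
    res d (fun i => C (c i) * f i) = (∏ i, c i ^ blockDegree d i) * res d f := by
  have hf₂ := isHomogeneous_update hf (k := 2) ((hf 2).C_mul (c 2))
  have hf₁ := isHomogeneous_update hf₂ (k := 1) ((hf₂ 1).C_mul (c 1))
  rw [Fin.prod_univ_three, mul_assoc, mul_assoc, ← res_update_C_mul hd 2 _ hf,
    ← res_update_C_mul hd 1 _ hf₂, ← res_update_C_mul hd 0 _ hf₁]
  congr 1
  funext i
  fin_cases i <;> simp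

/-- The substitution multiplying all variables by a parameter. -/
noncomputable def scale {σ : Type*} : MvPolynomial σ ℤ →+* Polynomial (MvPolynomial σ ℤ) :=
  subst fun v => Polynomial.X * Polynomial.C (X v)

theorem exists_eq_C_of_scale_eq {σ : Type*} {P E : MvPolynomial σ ℤ} {N : ℕ} (hP : P ≠ 0)
    (hscale : scale P = Polynomial.X ^ N * Polynomial.C P)
    (hscale_mul : scale (P * E) = Polynomial.X ^ N * Polynomial.C (P * E)) :
    ∃ a : ℤ, E = C a := by
  rw [map_mul, hscale, Polynomial.C_mul, ← mul_assoc] at hscale_mul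
  have hE := congrArg (Polynomial.evalRingHom 0) (mul_left_cancel₀
    (mul_ne_zero (pow_ne_zero _ Polynomial.X_ne_zero) (Polynomial.C_ne_zero.mpr hP)) hscale_mul)
  rw [scale, map_subst] at hE
  refine ⟨subst 0 E, ?_⟩
  rw [map_subst]
  simpa [eq_comm, Function.comp_def, Pi.zero_def] using hE

theorem res_dvd_res_of_forall_dvd {σ : Type*} [Finite σ] {e : Fin 3 → ℕ} (hd : ∀ i, 0 < d i)
    (he : ∀ i, 0 < e i) {f g : Fin 3 → MvPolynomial (Fin 3) (MvPolynomial σ ℤ)}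
    (hf : ∀ i, (f i).IsHomogeneous (d i)) (hg : ∀ i, (g i).IsHomogeneous (e i))
    (hfg : ∀ i, f i ∣ g i) (hprime : Prime (res d f)) {c : σ → ℂ} (hc : subst c (res d f) = 0) :
    res d f ∣ res e g := by
  refine dvd_of_forall_subst_eq_zero hprime hc fun c hc => ?_
  rw [map_res, res_eq_zero_iff hd fun i => (hf i).map _] at hc
  rw [map_res, res_eq_zero_iff he fun i => (hg i).map _]
  obtain ⟨z, hz, hzf⟩ := hc
  exact ⟨z, hz, fun i => zero_dvd_iff.mp <|
    hzf i ▸ map_dvd (eval z) (map_dvd (map (subst c)) (hfg i))⟩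

section Mul

variable {k : Fin 3} {n : ℕ}

theorem blockDegree_update_self (d : Fin 3 → ℕ) (k : Fin 3) (n : ℕ) :
    blockDegree (Function.update d k n) k = blockDegree d k :=
  Finset.prod_congr rfl fun i _ => by
    split_ifs with hi
    · rfl
    · rw [Function.update_of_ne hi]

theorem blockDegree_update_of_ne (d : Fin 3 → ℕ) (n : ℕ) {i : Fin 3} (hi : i ≠ k) :
    blockDegree (Function.update d k n) i =
      n * ∏ j ∈ Finset.univ.erase k, if j = i then 1 else d j := by
  rw [blockDegree, ← Finset.mul_prod_erase _ _ (Finset.mem_univ k), if_neg hi.symm,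
    Function.update_self]
  congr 1
  exact Finset.prod_congr rfl fun j hj => by rw [Function.update_of_ne (Finset.ne_of_mem_erase hj)]

theorem blockDegree_update_add (d : Fin 3 → ℕ) (n : ℕ) {i : Fin 3} (hi : i ≠ k) :
    blockDegree (Function.update d k (d k + n)) i =
      blockDegree d i + blockDegree (Function.update d k n) i := by
  conv_rhs => rw [← Function.update_eq_self k d]
  rw [Function.update_idem, blockDegree_update_of_ne d _ hi, blockDegree_update_of_ne d _ hi,
    blockDegree_update_of_ne d _ hi, add_mul]

theorem prod_pow_blockDegree_update_add (d : Fin 3 → ℕ) (k : Fin 3) (n : ℕ) (t : S) :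
    ∏ i, (if i = k then t * t else t) ^ blockDegree (Function.update d k (d k + n)) i =
      (∏ i, t ^ blockDegree d i) * ∏ i, t ^ blockDegree (Function.update d k n) i := by
  rw [← Finset.prod_mul_distrib]
  refine Finset.prod_congr rfl fun i _ => ?_
  split_ifs with hi
  · rw [hi, blockDegree_update_self, blockDegree_update_self, mul_pow]
  · rw [blockDegree_update_add d n hi, pow_add]

theorem isHomogeneous_update_update {σ ι : Type*} [DecidableEq ι] {d : ι → ℕ}
    {f : ι → MvPolynomial σ S} (hf : ∀ i, (f i).IsHomogeneous (d i)) {k : ι}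
    {g : MvPolynomial σ S} (hg : g.IsHomogeneous n) (i : ι) :
    (Function.update f k g i).IsHomogeneous (Function.update d k n i) := by
  rcases eq_or_ne i k with rfl | hi
  · simpa using hg
  · simpa [hi] using hf i

theorem update_pos (hd : ∀ i, 0 < d i) (hn : 0 < n) (i : Fin 3) : 0 < Function.update d k n i := by
  rcases eq_or_ne i k with rfl | hi
  · simpa using hn
  · simpa [hi] using hd i

theorem update_X_pow (d : Fin 3 → ℕ) (k : Fin 3) (n : ℕ) :
    Function.update (fun i => (X i ^ d i : MvPolynomial (Fin 3) S)) k (X k ^ n) =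
      fun i => X i ^ Function.update d k n i :=
  funext fun i => by rcases eq_or_ne i k with rfl | hi <;> simp [*]

/-- The generic triple of forms of degrees `d 0, d 1, d 2`, over the ring of polynomials in its
coefficients and those of a further form of degree `n`. -/
noncomputable def genericTriple (d : Fin 3 → ℕ) (n : ℕ) (i : Fin 3) :
    MvPolynomial (Fin 3) (MvPolynomial (CoeffIndex d ⊕ Exponents n) ℤ) :=
  ofCoeffs fun u : Exponents (d i) => X (.inl ⟨i, u⟩)

/-- The generic form of degree `n`, over the ring of polynomials in its coefficients and those of
a triple of forms of degrees `d 0, d 1, d 2`. -/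
noncomputable def genericExtra (d : Fin 3 → ℕ) (n : ℕ) :
    MvPolynomial (Fin 3) (MvPolynomial (CoeffIndex d ⊕ Exponents n) ℤ) :=
  ofCoeffs fun u : Exponents n => X (.inr u)

theorem isHomogeneous_genericTriple (d : Fin 3 → ℕ) (n : ℕ) (i : Fin 3) :
    (genericTriple d n i).IsHomogeneous (d i) := isHomogeneous_ofCoeffs _

theorem isHomogeneous_genericExtra (d : Fin 3 → ℕ) (n : ℕ) :
    (genericExtra d n).IsHomogeneous n := isHomogeneous_ofCoeffs _

theorem exists_map_subst_generic_eq {f : Fin 3 → MvPolynomial (Fin 3) S}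
    (hf : ∀ i, (f i).IsHomogeneous (d i)) {g : MvPolynomial (Fin 3) S} (hg : g.IsHomogeneous n) :
    ∃ c, (∀ i, map (subst c) (genericTriple d n i) = f i) ∧
      map (subst c) (genericExtra d n) = g :=
  ⟨Sum.elim (fun v => coeffs (d v.1) (f v.1) v.2) (coeffs n g),
    fun i => by simpa [genericTriple, map_ofCoeffs] using ofCoeffs_coeffs (hf i),
    by simpa [genericExtra, map_ofCoeffs] using ofCoeffs_coeffs hg⟩

theorem ofCoeffs_mul (t : S) (c : Exponents n → S) :
    ofCoeffs (fun u => t * c u) = C t * ofCoeffs c := by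
  refine ext_of_isHomogeneous (isHomogeneous_ofCoeffs _) ((isHomogeneous_ofCoeffs _).C_mul _) ?_
  rw [coeffs_ofCoeffs]
  funext u
  rw [coeffs, coeff_C_mul]
  exact congrArg (t * ·) (congrFun (coeffs_ofCoeffs c) u).symm

theorem map_scale_genericTriple (d : Fin 3 → ℕ) (n : ℕ) (i : Fin 3) :
    map scale (genericTriple d n i) = C Polynomial.X * map Polynomial.C (genericTriple d n i) := by
  simp only [genericTriple, map_ofCoeffs, ← ofCoeffs_mul, scale, subst_X]

theorem map_scale_genericExtra (d : Fin 3 → ℕ) (n : ℕ) :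
    map scale (genericExtra d n) = C Polynomial.X * map Polynomial.C (genericExtra d n) := by
  simp only [genericExtra, map_ofCoeffs, ← ofCoeffs_mul, scale, subst_X]

theorem prime_res_genericTriple (hd : ∀ i, 0 < d i) (n : ℕ) :
    Prime (res d (genericTriple d n)) := by
  have : res d (genericTriple d n) = rename Sum.inl (resultant d) := by
    rw [← subst_X_left (rename _ _), subst_rename]
    exact congrArg (subst · (resultant d)) (funext fun v => congrFun (coeffs_ofCoeffs _) v.2)
  exact this ▸ prime_rename_of_injective Sum.inl_injective (prime_resultant hd)

/-- The coefficient of the generic triple or extra form that becomes a given coefficient when the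
extra form replaces the form `k`. -/
noncomputable def replaceIndex (d : Fin 3 → ℕ) (k : Fin 3) (n : ℕ)
    (v : CoeffIndex (Function.update d k n)) : CoeffIndex d ⊕ Exponents n :=
  if h : v.1 = k then .inr ⟨v.2.1, by simpa [h] using v.2.2⟩
  else .inl ⟨v.1, v.2.1, by simpa [h] using v.2.2⟩

theorem replaceIndex_injective : Function.Injective (replaceIndex d k n) := by
  rintro ⟨i, u, hu⟩ ⟨j, w, hw⟩ h
  by_cases hi : i = k <;> by_cases hj : j = k
  · subst hi
    subst hj
    simpa [replaceIndex] using h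
  · simp [replaceIndex, hi, hj] at h
  · simp [replaceIndex, hi, hj] at h
  · simp only [replaceIndex, hi, hj, dite_false, Sum.inl.injEq, Sigma.mk.injEq] at h
    obtain ⟨rfl, h⟩ := h
    simpa using h

theorem prime_res_update_genericExtra (hd : ∀ i, 0 < d i) (hn : 0 < n) : Prime
    (res (Function.update d k n) (Function.update (genericTriple d n) k (genericExtra d n))) := by
  have : res (Function.update d k n) (Function.update (genericTriple d n) k (genericExtra d n)) =
      rename (replaceIndex d k n) (resultant (Function.update d k n)) := by
    rw [← subst_X_left (rename _ _), subst_rename]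
    refine congrArg (subst · _) (funext fun ⟨i, u, hu⟩ => ?_)
    by_cases hi : i = k
    · subst hi
      simp only [Function.update_self, replaceIndex, dite_true]
      exact congrFun (coeffs_ofCoeffs _) (⟨u, by simpa using hu⟩ : Exponents n)
    · simp only [Function.update_of_ne hi, replaceIndex, hi, dite_false]
      exact congrFun (coeffs_ofCoeffs _) (⟨u, by simpa [hi] using hu⟩ : Exponents (d i))
  exact this ▸ prime_rename_of_injective replaceIndex_injective (prime_resultant (update_pos hd hn))

theorem not_res_update_genericExtra_dvd (hd : ∀ i, 0 < d i) (hn : 0 < n) :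
    ¬ res (Function.update d k n) (Function.update (genericTriple d n) k (genericExtra d n)) ∣
      res d (genericTriple d n) := fun hdvd => by
  have hX (i) : (X i ^ d i : MvPolynomial (Fin 3) ℤ).IsHomogeneous (d i) := isHomogeneous_X_pow _ _
  have h0 : (0 : MvPolynomial (Fin 3) ℤ).IsHomogeneous n := isHomogeneous_zero _ _ _
  obtain ⟨c, hc, hc'⟩ := exists_map_subst_generic_eq hX h0
  have hdvd_one := map_dvd (subst c) hdvd
  simp only [map_res, map_update, hc, hc', res_X_pow hd] at hdvd_one
  rw [res_eq_zero_of_hasCommonZero (update_pos hd hn) (isHomogeneous_update_update hX h0)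
    ⟨Pi.single k 1, by simp, fun i => ?_⟩, zero_dvd_iff] at hdvd_one
  · exact one_ne_zero hdvd_one
  · rcases eq_or_ne i k with rfl | hi
    · simp
    · simp [hi, (hd i).ne']

theorem res_mul_res_dvd_res_update_mul_genericExtra (hd : ∀ i, 0 < d i) (hn : 0 < n) :
    res d (genericTriple d n) *
        res (Function.update d k n) (Function.update (genericTriple d n) k (genericExtra d n)) ∣
      res (Function.update d k (d k + n))
        (Function.update (genericTriple d n) k (genericTriple d n k * genericExtra d n)) := by
  have hF := isHomogeneous_genericTriple d n
  have hG := isHomogeneous_genericExtra d n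
  have hFG := isHomogeneous_update_update (k := k) hF ((hF k).mul hG)
  have hpos := update_pos (k := k) hd (Nat.add_pos_left (hd k) n)
  have h0 (m : ℕ) : (0 : MvPolynomial (Fin 3) ℂ).IsHomogeneous m := isHomogeneous_zero _ _ _
  obtain ⟨c, hc, hc'⟩ := exists_map_subst_generic_eq (fun i => h0 (d i)) (h0 n)
  obtain ⟨E, hE⟩ := res_dvd_res_of_forall_dvd hd hpos hF hFG
    (fun i => by rcases eq_or_ne i k with rfl | hi <;> simp [*])
    (prime_res_genericTriple hd n) (c := c) (by
      simp only [map_res, hc]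
      exact res_eq_zero_of_hasCommonZero hd (fun i => h0 _) ⟨1, one_ne_zero, by simp⟩)
  have hdvd := res_dvd_res_of_forall_dvd (update_pos (k := k) hd hn) hpos
    (isHomogeneous_update_update hF hG) hFG
    (fun i => by rcases eq_or_ne i k with rfl | hi <;> simp [*])
    (prime_res_update_genericExtra hd hn) (c := c) (by
      simp only [map_res, map_update, hc, hc']
      exact res_eq_zero_of_hasCommonZero (update_pos hd hn)
        (isHomogeneous_update_update (fun i => h0 _) (h0 n)) ⟨1, one_ne_zero, by simp⟩)
  rw [hE] at hdvd ⊢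
  exact mul_dvd_mul_left _ (((prime_res_update_genericExtra hd hn).dvd_or_dvd hdvd).resolve_left
    (not_res_update_genericExtra_dvd hd hn))

theorem scale_res_genericTriple_mul_res (hd : ∀ i, 0 < d i) (hn : 0 < n) :
    scale (res d (genericTriple d n) *
        res (Function.update d k n) (Function.update (genericTriple d n) k (genericExtra d n))) =
      Polynomial.X ^ (∑ i, blockDegree d i + ∑ i, blockDegree (Function.update d k n) i) *
        Polynomial.C (res d (genericTriple d n) * res (Function.update d k n)
          (Function.update (genericTriple d n) k (genericExtra d n))) := by
  have hF (i) := (isHomogeneous_genericTriple d n i).map (Polynomial.C : _ →+* Polynomial _)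
  have hG := (isHomogeneous_genericExtra d n).map (Polynomial.C : _ →+* Polynomial _)
  have hscale : Function.update
      (fun i => C Polynomial.X * map Polynomial.C (genericTriple d n i)) k
      (C Polynomial.X * map Polynomial.C (genericExtra d n)) =
      fun i => C Polynomial.X * Function.update (fun i => map Polynomial.C (genericTriple d n i)) k
        (map Polynomial.C (genericExtra d n)) i := by
    funext i
    rcases eq_or_ne i k with rfl | hi <;> simp [*]
  simp only [map_mul, map_res, map_update, map_scale_genericTriple, map_scale_genericExtra, hscale,
    res_C_mul hd _ hF, res_C_mul (update_pos hd hn) _ (isHomogeneous_update_update hF hG),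
    Finset.prod_pow_eq_pow_sum, pow_add]
  ring

theorem scale_res_update_mul_genericExtra (hd : ∀ i, 0 < d i) :
    scale (res (Function.update d k (d k + n))
        (Function.update (genericTriple d n) k (genericTriple d n k * genericExtra d n))) =
      Polynomial.X ^ (∑ i, blockDegree d i + ∑ i, blockDegree (Function.update d k n) i) *
        Polynomial.C (res (Function.update d k (d k + n))
          (Function.update (genericTriple d n) k (genericTriple d n k * genericExtra d n))) := by
  have hF (i) := (isHomogeneous_genericTriple d n i).map (Polynomial.C : _ →+* Polynomial _)
  have hG := (isHomogeneous_genericExtra d n).map (Polynomial.C : _ →+* Polynomial _)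
  have hscale : Function.update
      (fun i => C Polynomial.X * map Polynomial.C (genericTriple d n i)) k
      (C Polynomial.X * map Polynomial.C (genericTriple d n k) *
        (C Polynomial.X * map Polynomial.C (genericExtra d n))) =
      fun i => C (if i = k then Polynomial.X * Polynomial.X else Polynomial.X) *
        Function.update (fun i => map Polynomial.C (genericTriple d n i)) k
          (map Polynomial.C (genericTriple d n k) * map Polynomial.C (genericExtra d n)) i := by
    funext i
    rcases eq_or_ne i k with rfl | hi
    · simp [mul_mul_mul_comm]
    · simp [hi]
  simp only [map_mul, map_res, map_update, map_scale_genericTriple, map_scale_genericExtra, hscale,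
    res_C_mul (update_pos hd (Nat.add_pos_left (hd k) n)) _
      (isHomogeneous_update_update hF ((hF k).mul hG)), prod_pow_blockDegree_update_add,
    Finset.prod_pow_eq_pow_sum, pow_add]

theorem exists_res_update_mul_genericExtra_eq_mul_C (hd : ∀ i, 0 < d i) (hn : 0 < n) :
    ∃ a : ℤ, res (Function.update d k (d k + n))
        (Function.update (genericTriple d n) k (genericTriple d n k * genericExtra d n)) =
      res d (genericTriple d n) *
        res (Function.update d k n) (Function.update (genericTriple d n) k (genericExtra d n)) *
          C a := by
  obtain ⟨E, hE⟩ := res_mul_res_dvd_res_update_mul_genericExtra (k := k) hd hn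
  have hne := mul_ne_zero (prime_res_genericTriple hd n).ne_zero
    (prime_res_update_genericExtra (k := k) hd hn).ne_zero
  obtain ⟨a, rfl⟩ := exists_eq_C_of_scale_eq hne (scale_res_genericTriple_mul_res hd hn)
    (hE ▸ scale_res_update_mul_genericExtra hd)
  exact ⟨a, hE⟩

theorem res_update_mul (hd : ∀ i, 0 < d i) (hn : 0 < n) {f : Fin 3 → MvPolynomial (Fin 3) S}
    (hf : ∀ i, (f i).IsHomogeneous (d i)) {g : MvPolynomial (Fin 3) S} (hg : g.IsHomogeneous n) :
    res (Function.update d k (d k + n)) (Function.update f k (f k * g)) =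
      res d f * res (Function.update d k n) (Function.update f k g) := by
  obtain ⟨a, ha⟩ := exists_res_update_mul_genericExtra_eq_mul_C (k := k) hd hn
  have hone : a = 1 := by
    obtain ⟨c, hc, hc'⟩ := exists_map_subst_generic_eq (S := ℤ) (d := d) (n := n)
      (fun i => isHomogeneous_X_pow i _) (isHomogeneous_X_pow k n)
    have hval := congrArg (subst c) ha
    simp only [map_mul, map_res, map_update, hc, hc', ← pow_add, update_X_pow, res_X_pow hd,
      res_X_pow (update_pos hd hn), res_X_pow (update_pos hd (Nat.add_pos_left (hd k) n))] at hval
    simpa [subst] using hval.symm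
  obtain ⟨c, hc, hc'⟩ := exists_map_subst_generic_eq hf hg
  have hval := congrArg (subst c) ha
  simpa only [hone, C_1, mul_one, map_mul, map_res, map_update, hc, hc'] using hval

end Mul

/-! ### Content -/

theorem hasContentOne_iff_forall_prime {σ : Type*} {P : MvPolynomial σ ℤ} :
    HasContentOne P ↔ ∀ p : ℕ, p.Prime → ¬ (p : MvPolynomial σ ℤ) ∣ P := by
  simp_rw [HasContentOne, ← map_natCast (C : ℤ →+* MvPolynomial σ ℤ), C_dvd_iff_dvd_coeff]
  refine ⟨fun h p hp hdvd => (Nat.prime_iff_prime_int.mp hp).not_isUnit (isUnit_of_dvd_one ?_),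
    fun h => ?_⟩
  · exact h ▸ Finset.dvd_gcd fun m _ => hdvd m
  · rw [← Finset.normalize_gcd, normalize_eq_one, Int.isUnit_iff_natAbs_eq]
    by_contra hne
    obtain ⟨p, hp, hdvd⟩ := Nat.exists_prime_and_dvd hne
    refine h p hp fun m => ?_
    by_cases hm : m ∈ P.support
    · exact (Int.natCast_dvd.mpr hdvd).trans (Finset.gcd_dvd hm)
    · simp [notMem_support_iff.mp hm]

theorem HasContentOne.of_dvd {σ : Type*} {P Q : MvPolynomial σ ℤ} (hQ : HasContentOne Q)
    (h : P ∣ Q) : HasContentOne P :=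
  hasContentOne_iff_forall_prime.mpr fun p hp hdvd =>
    hasContentOne_iff_forall_prime.mp hQ p hp (hdvd.trans h)

theorem hasContentOne_X {σ : Type*} (v : σ) : HasContentOne (X v : MvPolynomial σ ℤ) := by
  simp [HasContentOne, support_X]

theorem hasContentOne_of_subst_eq_one {σ : Type*} {P : MvPolynomial σ ℤ} {c : σ → ℤ}
    (h : subst c P = 1) : HasContentOne P := by
  rw [hasContentOne_iff_forall_prime]
  rintro p hp ⟨Q, rfl⟩
  rw [map_mul, map_natCast] at h
  exact (Nat.prime_iff_prime_int.mp hp).not_isUnit (.of_mul_eq_one _ h)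

theorem hasContentOne_of_forall_isAlgClosed {σ : Type*} {P : MvPolynomial σ ℤ}
    (h : ∀ (K : Type) [Field K] [IsAlgClosed K], ∃ c : σ → K, subst c P ≠ 0) :
    HasContentOne P := by
  rw [hasContentOne_iff_forall_prime]
  rintro p hp ⟨Q, rfl⟩
  have := Fact.mk hp
  have := charP_of_injective_algebraMap
    (algebraMap (ZMod p) (AlgebraicClosure (ZMod p))).injective p
  obtain ⟨c, hc⟩ := h (AlgebraicClosure (ZMod p))
  exact hc (by simp)

theorem prime_natCast {σ : Type*} {p : ℕ} (hp : p.Prime) : Prime (p : MvPolynomial σ ℤ) := by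
  rw [← map_natCast (C : ℤ →+* MvPolynomial σ ℤ)]
  exact (prime_C_iff σ).mpr (Nat.prime_iff_prime_int.mp hp)

theorem HasContentOne.natCast_dvd_of_dvd_mul {σ : Type*} {P Q : MvPolynomial σ ℤ}
    (hQ : HasContentOne Q) {N : ℕ} (hN : N ≠ 0) (h : (N : MvPolynomial σ ℤ) ∣ P * Q) :
    (N : MvPolynomial σ ℤ) ∣ P := by
  induction N using Nat.recOnMul generalizing P with
  | zero => exact absurd rfl hN
  | one => simp
  | prime p hp =>
    exact ((prime_natCast hp).dvd_or_dvd h).resolve_right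
      (hasContentOne_iff_forall_prime.mp hQ p hp)
  | mul a b iha ihb =>
    have ha : a ≠ 0 := left_ne_zero_of_mul hN
    rw [Nat.cast_mul] at h ⊢
    obtain ⟨P', rfl⟩ := iha ha ((dvd_mul_right _ _).trans h)
    rw [mul_assoc] at h
    exact mul_dvd_mul_left _ (ihb (right_ne_zero_of_mul hN)
      ((mul_dvd_mul_iff_left (Nat.cast_ne_zero.mpr ha)).mp h))

theorem HasContentOne.exists_eq_natCast_mul {σ : Type*} {P Q R : MvPolynomial σ ℤ}
    (hQ : HasContentOne Q) (hR : HasContentOne R) {N : ℕ} (hN : N ≠ 0)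
    (h : P * Q = (N : MvPolynomial σ ℤ) * R) :
    ∃ P', HasContentOne P' ∧ P = (N : MvPolynomial σ ℤ) * P' := by
  obtain ⟨P', rfl⟩ := hQ.natCast_dvd_of_dvd_mul hN ⟨R, h⟩
  rw [mul_assoc] at h
  exact ⟨P', hR.of_dvd ⟨Q, (mul_left_cancel₀ (Nat.cast_ne_zero.mpr hN) h).symm⟩, rfl⟩

theorem HasContentOne.isUnit_of_eq_C_mul {σ : Type*} {a : ℤ} {P Q : MvPolynomial σ ℤ}
    (hP : HasContentOne P) (h : P = C a * Q) : IsUnit a := by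
  rw [Int.isUnit_iff_natAbs_eq]
  by_contra hne
  obtain ⟨p, hp, hdvd⟩ := Nat.exists_prime_and_dvd hne
  refine hasContentOne_iff_forall_prime.mp hP p hp (h ▸ Dvd.dvd.mul_right ?_ _)
  rw [← map_natCast (C : ℤ →+* MvPolynomial σ ℤ)]
  exact map_dvd C (Int.natCast_dvd.mpr hdvd)

/-! ### The resultant of the partial derivatives -/

/-- The generic ternary form of degree `n`. -/
noncomputable def genericForm (n : ℕ) : MvPolynomial (Fin 3) (MvPolynomial (Exponents n) ℤ) :=
  ofCoeffs X

theorem isHomogeneous_genericForm (n : ℕ) : (genericForm n).IsHomogeneous n :=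
  isHomogeneous_ofCoeffs _

theorem map_subst_genericForm {n : ℕ} {f : MvPolynomial (Fin 3) S} (hf : f.IsHomogeneous n) :
    map (subst (coeffs n f)) (genericForm n) = f := by
  rw [genericForm, map_ofCoeffs]
  simpa only [subst_X] using ofCoeffs_coeffs hf

theorem update_vec_zero {α : Type*} (a b c x : α) : Function.update ![a, b, c] 0 x = ![x, b, c] :=
  funext fun i => by fin_cases i <;> rfl

theorem update_vec_one {α : Type*} (a b c x : α) : Function.update ![a, b, c] 1 x = ![a, x, c] :=
  funext fun i => by fin_cases i <;> rfl

theorem update_vec_two {α : Type*} (a b c x : α) : Function.update ![a, b, c] 2 x = ![a, b, x] :=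
  funext fun i => by fin_cases i <;> rfl

theorem map_vec (φ : S →+* T) (a b c : MvPolynomial (Fin 3) S) :
    (fun i => map φ (![a, b, c] i)) = ![map φ a, map φ b, map φ c] :=
  funext fun i => by fin_cases i <;> rfl

theorem isHomogeneous_vec {a b c : MvPolynomial (Fin 3) S} {l m n : ℕ} (ha : a.IsHomogeneous l)
    (hb : b.IsHomogeneous m) (hc : c.IsHomogeneous n) (i : Fin 3) :
    (![a, b, c] i).IsHomogeneous (![l, m, n] i) := by
  fin_cases i
  exacts [ha, hb, hc]

theorem pos_vec {l m n : ℕ} (hl : 0 < l) (hm : 0 < m) (hn : 0 < n) (i : Fin 3) :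
    0 < ![l, m, n] i := by
  fin_cases i
  exacts [hl, hm, hn]

/-- The resultant of the partial derivatives of a form of degree `n`. -/
noncomputable def polarRes (n : ℕ) (f : MvPolynomial (Fin 3) S) : S :=
  res (fun _ => n - 1) fun i => pderiv i f

/-- The resultant of `x₀` and the partial derivatives in `x₁` and `x₂`, by which `polarRes` and
`criticalRes` differ. -/
noncomputable def lineRes (n : ℕ) (f : MvPolynomial (Fin 3) S) : S :=
  res ![1, n - 1, n - 1] ![X 0, pderiv 1 f, pderiv 2 f]

/-- The resultant of a form of degree `n` and its partial derivatives in `x₁` and `x₂`. -/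
noncomputable def criticalRes (n : ℕ) (f : MvPolynomial (Fin 3) S) : S :=
  res ![n, n - 1, n - 1] ![f, pderiv 1 f, pderiv 2 f]

/-- The resultant of `x₀`, a form of degree `n` and its partial derivative in `x₂`: this is
`criticalRes` for the restriction of the form to the line `x₀ = 0`. -/
noncomputable def lineCriticalRes (n : ℕ) (f : MvPolynomial (Fin 3) S) : S :=
  res ![1, n, n - 1] ![X 0, f, pderiv 2 f]

theorem map_polarRes (φ : S →+* T) (n : ℕ) (f : MvPolynomial (Fin 3) S) :
    φ (polarRes n f) = polarRes n (map φ f) := by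
  simp only [polarRes, map_res, pderiv_map]

theorem map_lineRes (φ : S →+* T) (n : ℕ) (f : MvPolynomial (Fin 3) S) :
    φ (lineRes n f) = lineRes n (map φ f) := by
  simp only [lineRes, map_res, map_vec, pderiv_map, map_X]

theorem map_criticalRes (φ : S →+* T) (n : ℕ) (f : MvPolynomial (Fin 3) S) :
    φ (criticalRes n f) = criticalRes n (map φ f) := by
  simp only [criticalRes, map_res, map_vec, pderiv_map]

theorem map_lineCriticalRes (φ : S →+* T) (n : ℕ) (f : MvPolynomial (Fin 3) S) :
    φ (lineCriticalRes n f) = lineCriticalRes n (map φ f) := by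
  simp only [lineCriticalRes, map_res, map_vec, pderiv_map, map_X]

theorem sub_C_coeff_mul_X_pow_mem_span {σ : Type*} {n : ℕ} {f : MvPolynomial σ S}
    (hf : f.IsHomogeneous n) (i : σ) :
    f - C (f.coeff (Finsupp.single i n)) * X i ^ n ∈
      Ideal.span ((X : σ → MvPolynomial σ S) '' {i}ᶜ) := by
  classical
  rw [mem_ideal_span_X_image]
  intro m hm
  by_contra! hzero
  have hsingle : m = Finsupp.single i (m i) := Finsupp.ext fun j => by
    rcases eq_or_ne j i with rfl | hj
    · simp
    · simp [hzero j hj, hj.symm]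
  have hdeg : m i = n := by
    have h := of_not_not (mt (hf.sub ((isHomogeneous_X_pow i n).C_mul _)).coeff_eq_zero
      (mem_support_iff.mp hm))
    rwa [hsingle, Finsupp.degree_single] at h
  rw [hsingle, hdeg] at hm
  simp [X_pow_eq_monomial] at hm

theorem res_X_X [IsDomain S] {m : ℕ} (hm : 0 < m) {g : MvPolynomial (Fin 3) S}
    (hg : g.IsHomogeneous m) :
    res ![1, 1, m] ![X 0, X 1, g] = g.coeff (Finsupp.single 2 m) := by
  have hd := pos_vec one_pos one_pos hm
  have hX (i) : (X i ^ ![1, 1, m] i : MvPolynomial (Fin 3) S).IsHomogeneous (![1, 1, m] i) :=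
    isHomogeneous_X_pow _ _
  have hpow : (fun i => X i ^ ![1, 1, m] i : Fin 3 → MvPolynomial (Fin 3) S) =
      ![X 0, X 1, X 2 ^ m] := funext fun i => by fin_cases i <;> simp
  have hscale := isHomogeneous_update (k := 2) hX ((hX 2).C_mul (g.coeff (Finsupp.single 2 m)))
  have hadd := res_update_add hd hscale (k := 2)
    (hg.sub ((isHomogeneous_X_pow 2 m).C_mul (g.coeff (Finsupp.single 2 m)))) (by
      refine Ideal.span_mono ?_ (sub_C_coeff_mul_X_pow_mem_span hg 2)
      rintro _ ⟨i, hi, rfl⟩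
      refine ⟨i, hi, ?_⟩
      fin_cases i <;> simp_all)
  rw [res_update_C_mul hd 2 _ hX, res_X_pow hd, hpow] at hadd
  simpa [update_vec_two, blockDegree, Fin.prod_univ_three] using hadd

theorem res_mul_res_of_sub_mem_span [IsDomain S] (hd : ∀ i, 0 < d i) {n : ℕ} (hn : 0 < n)
    {k : Fin 3} {f : Fin 3 → MvPolynomial (Fin 3) S} (hf : ∀ i, (f i).IsHomogeneous (d i))
    {g h : MvPolynomial (Fin 3) S} (hg : g.IsHomogeneous n) (hh : h.IsHomogeneous (d k + n))
    {a : S} (hspan : f k * g - C a * h ∈ Ideal.span (f '' {k}ᶜ)) :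
    res d f * res (Function.update d k n) (Function.update f k g) =
      a ^ blockDegree d k *
        res (Function.update d k (d k + n)) (Function.update f k h) := by
  have hpos := update_pos (k := k) hd (Nat.add_pos_left (hd k) n)
  have hfh := isHomogeneous_update_update (k := k) hf hh
  have hadd := res_update_add (k := k) (g := f k * g - C a * h) hpos
    (isHomogeneous_update_update (k := k) hf (hh.C_mul a))
    (by simpa using ((hf k).mul hg).sub (hh.C_mul a)) (by
      refine Ideal.span_mono ?_ hspan
      rintro _ ⟨i, hi, rfl⟩
      exact ⟨i, hi, Function.update_of_ne hi _ _⟩)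
  have hscale := res_update_C_mul hpos k a hfh
  simp only [Function.update_self, Function.update_idem, add_sub_cancel,
    blockDegree_update_self] at hadd hscale
  rw [← res_update_mul hd hn hf hg, hadd, hscale]

theorem sum_X_mul_pderiv {n : ℕ} {f : MvPolynomial (Fin 3) S} (hf : f.IsHomogeneous n) :
    X 0 * pderiv 0 f + X 1 * pderiv 1 f + X 2 * pderiv 2 f = C (n : S) * f := by
  simpa [Fin.sum_univ_three] using hf.sum_X_mul_pderiv

theorem lineRes_mul_polarRes [IsDomain S] {n : ℕ} (hn : 2 ≤ n) {f : MvPolynomial (Fin 3) S}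
    (hf : f.IsHomogeneous n) :
    lineRes n f * polarRes n f = n ^ (n - 1) ^ 2 * criticalRes n f := by
  have hm : 0 < n - 1 := by omega
  have hdeg : 1 + (n - 1) = n := by omega
  have hEuler : X 0 * pderiv 0 f - C (n : S) * f = -(X 1 * pderiv 1 f + X 2 * pderiv 2 f) := by
    linear_combination sum_X_mul_pderiv hf
  have hspan : X 0 * pderiv 0 f - C (n : S) * f ∈
      Ideal.span (![X 0, pderiv 1 f, pderiv 2 f] '' {0}ᶜ) := hEuler ▸ neg_mem (add_mem
    (Ideal.mul_mem_left _ _ (Ideal.subset_span ⟨1, by simp, rfl⟩))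
    (Ideal.mul_mem_left _ _ (Ideal.subset_span ⟨2, by simp, rfl⟩)))
  have hres := res_mul_res_of_sub_mem_span (k := 0) (h := f) (a := (n : S))
    (pos_vec one_pos hm hm) hm (isHomogeneous_vec (isHomogeneous_X S 0) hf.pderiv hf.pderiv)
    (hf.pderiv (i := 0)) (by simpa [hdeg] using hf) hspan
  have hpolar : ![pderiv 0 f, pderiv 1 f, pderiv 2 f] = fun i => pderiv i f :=
    funext fun i => by fin_cases i <;> rfl
  have hdegs : ![n - 1, n - 1, n - 1] = fun _ => n - 1 := funext fun i => by fin_cases i <;> rfl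
  have hblock : blockDegree ![1, n - 1, n - 1] 0 = (n - 1) ^ 2 := by
    simp [blockDegree, Fin.prod_univ_three, sq]
  simpa only [lineRes, polarRes, criticalRes, update_vec_zero, Matrix.cons_val_zero, hdeg, hpolar,
    hdegs, hblock] using hres

theorem coeff_single_pderiv {σ : Type*} {n : ℕ} (hn : 0 < n) (f : MvPolynomial σ S) (i : σ) :
    (pderiv i f).coeff (Finsupp.single i (n - 1)) = n * f.coeff (Finsupp.single i n) := by
  obtain ⟨m, rfl⟩ := Nat.exists_eq_add_one.mpr hn
  rw [coeff_pderiv, Nat.add_sub_cancel, ← Finsupp.single_add, Finsupp.single_eq_same, mul_comm,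
    Nat.cast_add_one]

theorem coeff_mul_lineRes [IsDomain S] {n : ℕ} (hn : 2 ≤ n) {f : MvPolynomial (Fin 3) S}
    (hf : f.IsHomogeneous n) :
    (n * f.coeff (Finsupp.single 2 n)) * lineRes n f = n ^ (n - 1) * lineCriticalRes n f := by
  have hm : 0 < n - 1 := by omega
  have hdeg : 1 + (n - 1) = n := by omega
  have hEuler : X 1 * pderiv 1 f - C (n : S) * f = -(pderiv 0 f * X 0 + X 2 * pderiv 2 f) := by
    linear_combination sum_X_mul_pderiv hf
  have hspan : X 1 * pderiv 1 f - C (n : S) * f ∈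
      Ideal.span (![X 0, X 1, pderiv 2 f] '' {1}ᶜ) := hEuler ▸ neg_mem (add_mem
    (Ideal.mul_mem_left _ _ (Ideal.subset_span ⟨0, by simp, rfl⟩))
    (Ideal.mul_mem_left _ _ (Ideal.subset_span ⟨2, by simp, rfl⟩)))
  have hres := res_mul_res_of_sub_mem_span (k := 1) (h := f) (a := (n : S))
    (pos_vec one_pos one_pos hm) hm
    (isHomogeneous_vec (isHomogeneous_X S 0) (isHomogeneous_X S 1) hf.pderiv)
    (hf.pderiv (i := 1)) (by simpa [hdeg] using hf) hspan
  have hblock : blockDegree ![1, 1, n - 1] 1 = n - 1 := by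
    simp [blockDegree, Fin.prod_univ_three]
  rw [res_X_X hm hf.pderiv, coeff_single_pderiv (by omega), hblock] at hres
  simpa only [lineRes, lineCriticalRes, update_vec_one, Matrix.cons_val_one, Matrix.cons_val_zero,
    hdeg] using hres

/-! ### The content of the resultant of the partial derivatives -/

theorem criticalRes_ne_zero {K : Type*} [Field K] [IsAlgClosed K] {n : ℕ} (hn : 2 ≤ n)
    {f : MvPolynomial (Fin 3) K} (hf : f.IsHomogeneous n)
    (h : ∀ z, eval z f = 0 → eval z (pderiv 1 f) = 0 → eval z (pderiv 2 f) = 0 → z = 0) :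
    criticalRes n f ≠ 0 := by
  have hm : 0 < n - 1 := by omega
  rw [criticalRes, Ne, res_eq_zero_iff (pos_vec (by omega) hm hm)
    (isHomogeneous_vec hf hf.pderiv hf.pderiv)]
  rintro ⟨z, hz, hzf⟩
  exact hz (h z (hzf 0) (hzf 1) (hzf 2))

theorem lineCriticalRes_ne_zero {K : Type*} [Field K] [IsAlgClosed K] {n : ℕ} (hn : 2 ≤ n)
    {f : MvPolynomial (Fin 3) K} (hf : f.IsHomogeneous n)
    (h : ∀ z, z 0 = 0 → eval z f = 0 → eval z (pderiv 2 f) = 0 → z = 0) :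
    lineCriticalRes n f ≠ 0 := by
  have hm : 0 < n - 1 := by omega
  rw [lineCriticalRes, Ne, res_eq_zero_iff (pos_vec one_pos (by omega) hm)
    (isHomogeneous_vec (isHomogeneous_X K 0) hf hf.pderiv)]
  rintro ⟨z, hz, hzf⟩
  exact hz (h z (by simpa using hzf 0) (hzf 1) (hzf 2))

theorem eq_zero_of_forall_fin_three {K : Type*} [Zero K] {z : Fin 3 → K} (h0 : z 0 = 0)
    (h1 : z 1 = 0) (h2 : z 2 = 0) : z = 0 :=
  funext fun i => by fin_cases i <;> assumption

/-- The Fermat form of degree `n`, nonsingular in characteristics not dividing `n`. -/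
noncomputable def fermatForm (n : ℕ) : MvPolynomial (Fin 3) S :=
  X 0 ^ n + X 1 ^ n + X 2 ^ n

theorem isHomogeneous_fermatForm (n : ℕ) :
    (fermatForm n : MvPolynomial (Fin 3) S).IsHomogeneous n :=
  ((isHomogeneous_X_pow _ _).add (isHomogeneous_X_pow _ _)).add (isHomogeneous_X_pow _ _)

theorem pderiv_fermatForm (n : ℕ) (i : Fin 3) :
    pderiv i (fermatForm n) = C (n : S) * X i ^ (n - 1) := by
  rw [map_natCast]
  fin_cases i <;> simp [fermatForm, pderiv_X]

/-- A form of degree `n` which is nonsingular in characteristics dividing `n`. -/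
noncomputable def chainForm (n : ℕ) : MvPolynomial (Fin 3) S :=
  X 0 ^ (n - 1) * X 1 + X 1 ^ (n - 1) * X 2 + X 2 ^ n

theorem isHomogeneous_X_pow_mul_X {σ : Type*} {n : ℕ} (hn : 0 < n) (i j : σ) :
    (X i ^ (n - 1) * X j : MvPolynomial σ S).IsHomogeneous n := by
  simpa only [Nat.sub_add_cancel hn] using
    (isHomogeneous_X_pow (R := S) i (n - 1)).mul (isHomogeneous_X S j)

theorem isHomogeneous_chainForm {n : ℕ} (hn : 0 < n) :
    (chainForm n : MvPolynomial (Fin 3) S).IsHomogeneous n :=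
  ((isHomogeneous_X_pow_mul_X hn 0 1).add (isHomogeneous_X_pow_mul_X hn 1 2)).add
    (isHomogeneous_X_pow _ _)

theorem eval_pderiv_one_chainForm (n : ℕ) (z : Fin 3 → S) :
    eval z (pderiv 1 (chainForm n)) =
      z 0 ^ (n - 1) + (n - 1 : ℕ) * z 1 ^ (n - 1 - 1) * z 2 := by
  simp [chainForm, pderiv_X, mul_comm]

theorem eval_pderiv_two_chainForm (n : ℕ) (z : Fin 3 → S) :
    eval z (pderiv 2 (chainForm n)) = z 1 ^ (n - 1) + n * z 2 ^ (n - 1) := by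
  simp [chainForm, pderiv_X]

section NonvanishingForms

variable {K : Type*} [Field K] [IsAlgClosed K] {n : ℕ}

theorem criticalRes_fermatForm_ne_zero (hn : 2 ≤ n) (hnK : (n : K) ≠ 0) :
    criticalRes n (fermatForm n : MvPolynomial (Fin 3) K) ≠ 0 ∧
      lineCriticalRes n (fermatForm n : MvPolynomial (Fin 3) K) ≠ 0 := by
  have hn0 : n ≠ 0 := by omega
  have hcoord {z : Fin 3 → K} {i : Fin 3} (h : eval z (pderiv i (fermatForm n)) = 0) :
      z i = 0 := by
    rw [pderiv_fermatForm, map_mul, eval_C, map_pow, eval_X] at h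
    exact eq_zero_of_pow_eq_zero ((mul_eq_zero.mp h).resolve_left hnK)
  have hval (z : Fin 3 → K) : eval z (fermatForm n) = z 0 ^ n + z 1 ^ n + z 2 ^ n := by
    simp [fermatForm]
  refine ⟨criticalRes_ne_zero hn (isHomogeneous_fermatForm n) fun z hz hz1 hz2 => ?_,
    lineCriticalRes_ne_zero hn (isHomogeneous_fermatForm n) fun z hz0 hz hz2 => ?_⟩
  · rw [hval, hcoord hz1, hcoord hz2, zero_pow hn0, add_zero, add_zero] at hz
    exact eq_zero_of_forall_fin_three (eq_zero_of_pow_eq_zero hz) (hcoord hz1) (hcoord hz2)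
  · rw [hval, hz0, hcoord hz2, zero_pow hn0, zero_add, add_zero] at hz
    exact eq_zero_of_forall_fin_three hz0 (eq_zero_of_pow_eq_zero hz) (hcoord hz2)

theorem criticalRes_chainForm_ne_zero (hn : 2 ≤ n) (hnK : (n : K) = 0) :
    criticalRes n (chainForm n : MvPolynomial (Fin 3) K) ≠ 0 ∧
      lineCriticalRes n (chainForm n : MvPolynomial (Fin 3) K) ≠ 0 := by
  have hm : n - 1 ≠ 0 := by omega
  have hone {z : Fin 3 → K} (h : eval z (pderiv 2 (chainForm n)) = 0) : z 1 = 0 := by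
    rw [eval_pderiv_two_chainForm, hnK, zero_mul, add_zero] at h
    exact eq_zero_of_pow_eq_zero h
  have htwo {z : Fin 3 → K} (h : eval z (chainForm n) = 0) (h1 : z 1 = 0) : z 2 = 0 := by
    simp only [chainForm, map_add, map_mul, map_pow, eval_X, h1, mul_zero, zero_pow hm, zero_mul,
      zero_add] at h
    exact eq_zero_of_pow_eq_zero h
  have hhom := isHomogeneous_chainForm (S := K) (by omega : 0 < n)
  refine ⟨criticalRes_ne_zero hn hhom fun z hz hz1 hz2 => ?_,
    lineCriticalRes_ne_zero hn hhom fun z hz0 hz hz2 =>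
      eq_zero_of_forall_fin_three hz0 (hone hz2) (htwo hz (hone hz2))⟩
  rw [eval_pderiv_one_chainForm, htwo hz (hone hz2), mul_zero, add_zero] at hz1
  exact eq_zero_of_forall_fin_three (eq_zero_of_pow_eq_zero hz1) (hone hz2) (htwo hz (hone hz2))

variable (K) in
theorem exists_criticalRes_ne_zero (hn : 2 ≤ n) :
    ∃ f : MvPolynomial (Fin 3) K, f.IsHomogeneous n ∧ criticalRes n f ≠ 0 ∧
      lineCriticalRes n f ≠ 0 := by
  by_cases hnK : (n : K) = 0
  · exact ⟨chainForm n, isHomogeneous_chainForm (by omega), criticalRes_chainForm_ne_zero hn hnK⟩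
  · exact ⟨fermatForm n, isHomogeneous_fermatForm n, criticalRes_fermatForm_ne_zero hn hnK⟩

end NonvanishingForms

theorem hasContentOne_criticalRes {n : ℕ} (hn : 2 ≤ n) :
    HasContentOne (criticalRes n (genericForm n)) := by
  refine hasContentOne_of_forall_isAlgClosed fun K _ _ => ?_
  obtain ⟨f, hf, hcrit, -⟩ := exists_criticalRes_ne_zero K hn
  exact ⟨coeffs n f, by rwa [map_criticalRes, map_subst_genericForm hf]⟩

theorem hasContentOne_lineCriticalRes {n : ℕ} (hn : 2 ≤ n) :
    HasContentOne (lineCriticalRes n (genericForm n)) := by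
  refine hasContentOne_of_forall_isAlgClosed fun K _ _ => ?_
  obtain ⟨f, hf, -, hline⟩ := exists_criticalRes_ne_zero K hn
  exact ⟨coeffs n f, by rwa [map_lineCriticalRes, map_subst_genericForm hf]⟩

theorem coeff_genericForm (n : ℕ) (u : Exponents n) : (genericForm n).coeff u.1 = X u :=
  congrFun (coeffs_ofCoeffs X) u

theorem exists_hasContentOne_polarRes {n : ℕ} (hn : 2 ≤ n) : ∃ P, HasContentOne P ∧
    polarRes n (genericForm n) =
      (n : MvPolynomial (Exponents n) ℤ) ^ ((n - 1) ^ 2 - (n - 2)) * P := by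
  have hn0 : (n : MvPolynomial (Exponents n) ℤ) ≠ 0 := Nat.cast_ne_zero.mpr (by omega)
  have hpow (k : ℕ) : n ^ k ≠ 0 := pow_ne_zero _ (by omega)
  have hle : n - 2 ≤ (n - 1) ^ 2 :=
    (Nat.sub_le_sub_left one_le_two n).trans (Nat.le_self_pow two_ne_zero _)
  have hlineRes : lineRes n (genericForm n) * X (pureExponent 2 n) =
      ((n ^ (n - 2) : ℕ) : MvPolynomial (Exponents n) ℤ) * lineCriticalRes n (genericForm n) := by
    refine mul_left_cancel₀ hn0 ?_
    have h := coeff_mul_lineRes hn (isHomogeneous_genericForm n)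
    rw [show n - 1 = n - 2 + 1 by omega, pow_succ',
      show (genericForm n).coeff (Finsupp.single 2 n) = X (pureExponent 2 n) from
        coeff_genericForm n (pureExponent 2 n)] at h
    rw [Nat.cast_pow]
    linear_combination h
  obtain ⟨L, hL, hlineL⟩ := (hasContentOne_X _).exists_eq_natCast_mul
    (hasContentOne_lineCriticalRes hn) (hpow _) hlineRes
  have hpolar : polarRes n (genericForm n) * L =
      ((n ^ ((n - 1) ^ 2 - (n - 2)) : ℕ) : MvPolynomial (Exponents n) ℤ) *
        criticalRes n (genericForm n) := by
    refine mul_left_cancel₀ (pow_ne_zero (n - 2) hn0) ?_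
    have h := lineRes_mul_polarRes hn (isHomogeneous_genericForm n)
    rw [hlineL, Nat.cast_pow] at h
    rw [Nat.cast_pow, ← mul_assoc (_ ^ _) (_ ^ _), ← pow_add, Nat.add_sub_cancel' hle, ← h]
    ring
  simpa only [Nat.cast_pow] using
    hL.exists_eq_natCast_mul (hasContentOne_criticalRes hn) (hpow _) hpolar

/-! ### Singular forms -/

section ForceSingular

variable {σ : Type*} [Fintype σ]

/-- The form `ℓ(z) ^ n * f - ℓ(z) * ℓ ^ (n - 1) * D + (n - 1) * f(z) * ℓ ^ n`, where `ℓ` is the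
linear form with coefficients `l` and `D = ∑ i, (∂ᵢ f)(z) * x i`. It is the analogue of `forceZero`
for forms of degree `n` which are singular at `z`. -/
noncomputable def forceSingular (n : ℕ) (f : MvPolynomial σ S) (z l : σ → S) : MvPolynomial σ S :=
  C (eval z (linearForm l) ^ n) * f -
    C (eval z (linearForm l)) *
      (linearForm l ^ (n - 1) * linearForm fun i => eval z (pderiv i f)) +
    C ((n - 1 : ℕ) * eval z f) * linearForm l ^ n

theorem isHomogeneous_forceSingular {n : ℕ} (hn : 0 < n) {f : MvPolynomial σ S}
    (hf : f.IsHomogeneous n) (z l : σ → S) : (forceSingular n f z l).IsHomogeneous n := by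
  have hl := isHomogeneous_linearForm l
  have htangent := (hl.pow (n - 1)).mul (isHomogeneous_linearForm fun i => eval z (pderiv i f))
  have hpow := hl.pow n
  rw [one_mul, Nat.sub_add_cancel hn] at htangent
  rw [one_mul] at hpow
  exact ((hf.C_mul _).sub (htangent.C_mul _)).add (hpow.C_mul _)

theorem pderiv_linearForm (l : σ → S) (j : σ) : pderiv j (linearForm l) = C (l j) := by
  classical
  simp [linearForm, pderiv_X, Pi.single_apply]

theorem eval_pderiv_forceSingular {n : ℕ} (hn : 0 < n) {f : MvPolynomial σ S}
    (hf : f.IsHomogeneous n) (z l : σ → S) (j : σ) :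
    eval z (pderiv j (forceSingular n f z l)) = 0 := by
  obtain ⟨m, rfl⟩ := Nat.exists_eq_add_one.mpr hn
  have hEuler : eval z (linearForm fun i => eval z (pderiv i f)) = (m + 1 : ℕ) * eval z f := by
    simpa [mul_comm] using congrArg (eval z) hf.sum_X_mul_pderiv
  rw [forceSingular, map_add, map_sub, pderiv_C_mul, pderiv_C_mul, pderiv_C_mul, pderiv_mul,
    pderiv_pow, pderiv_pow, pderiv_linearForm, pderiv_linearForm]
  simp only [map_add, map_sub, map_mul, map_pow, eval_C, hEuler, map_natCast,
    Nat.add_sub_cancel]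
  rcases m with _ | m
  · simp
  · simp only [Nat.add_sub_cancel]
    push_cast
    ring

theorem map_forceSingular (φ : S →+* T) (n : ℕ) (f : MvPolynomial σ S) (z l : σ → S) :
    map φ (forceSingular n f z l) = forceSingular n (map φ f) (φ ∘ z) (φ ∘ l) := by
  simp only [forceSingular, map_add, map_sub, map_mul, map_pow, map_C, map_linearForm,
    map_eval φ, map_natCast, pderiv_map, Function.comp_def]

theorem forceSingular_of_eval_eq_zero {n : ℕ} {f : MvPolynomial σ S} {z l : σ → S}
    (hf : eval z f = 0) (hd : ∀ i, eval z (pderiv i f) = 0) (hl : eval z (linearForm l) = 1) :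
    forceSingular n f z l = f := by
  rw [forceSingular, hl, hf]
  simp [hd, linearForm]

end ForceSingular

/-- The generic form of degree `n` with a singular zero: both the zero and the linear form used in
`forceSingular` have independent variables as coordinates. -/
noncomputable def singularForm (n : ℕ) :
    MvPolynomial (Fin 3) (MvPolynomial (Exponents n ⊕ (Fin 3 ⊕ Fin 3)) ℤ) :=
  forceSingular n (ofCoeffs fun u => X (.inl u)) (fun i => X (.inr (.inl i)))
    fun i => X (.inr (.inr i))

theorem isHomogeneous_singularForm {n : ℕ} (hn : 0 < n) : (singularForm n).IsHomogeneous n :=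
  isHomogeneous_forceSingular hn (isHomogeneous_ofCoeffs _) _ _

theorem polarRes_singularForm {n : ℕ} (hn : 2 ≤ n) : polarRes n (singularForm n) = 0 :=
  res_eq_zero_of_hasCommonZero (fun _ => by omega)
    (fun _ => (isHomogeneous_singularForm (by omega)).pderiv)
    ⟨fun i => X (.inr (.inl i)), Function.ne_iff.mpr ⟨0, X_ne_zero _⟩,
      eval_pderiv_forceSingular (by omega) (isHomogeneous_ofCoeffs _) _ _⟩

theorem map_subst_coeffs (φ : S →+* T) {n : ℕ} (f : MvPolynomial (Fin 3) S)
    (P : MvPolynomial (Exponents n) ℤ) :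
    φ (subst (coeffs n f) P) = subst (coeffs n (map φ f)) P := by
  rw [map_subst]
  exact congrArg (fun c => subst c P) (funext fun u => (coeff_map φ f u.1).symm)

theorem subst_eq_zero_of_isSingular {n : ℕ} {P : MvPolynomial (Exponents n) ℤ}
    (hP : subst (coeffs n (singularForm n)) P = 0) {f : MvPolynomial (Fin 3) ℂ}
    (hf : f.IsHomogeneous n) (h : IsSingular f) : subst (coeffs n f) P = 0 := by
  obtain ⟨z, hz, hzf, hzd⟩ := h
  obtain ⟨l, hl⟩ := exists_eval_linearForm_eq_one hz
  let φ : MvPolynomial (Exponents n ⊕ (Fin 3 ⊕ Fin 3)) ℤ →+* ℂ :=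
    subst (Sum.elim (coeffs n f) (Sum.elim z l))
  have hφ : map φ (singularForm n) = f := by
    rw [singularForm, map_forceSingular, map_ofCoeffs]
    simpa only [φ, subst_X, Function.comp_def, Sum.elim_inl, Sum.elim_inr, ofCoeffs_coeffs hf]
      using forceSingular_of_eval_eq_zero hzf hzd hl
  rw [← hφ, ← map_subst_coeffs, hP, map_zero]

theorem polarRes_eq_zero_iff {n : ℕ} (hn : 2 ≤ n) {f : MvPolynomial (Fin 3) ℂ}
    (hf : f.IsHomogeneous n) : polarRes n f = 0 ↔ IsSingular f := by
  rw [polarRes, res_eq_zero_iff (fun _ => by omega) fun i => hf.pderiv]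
  refine exists_congr fun z => and_congr_right fun _ => ⟨fun h => ⟨?_, h⟩, fun h => h.2⟩
  have hEuler := congrArg (eval z) (sum_X_mul_pderiv hf)
  simp only [map_add, map_mul, h, mul_zero, add_zero, eval_C] at hEuler
  exact (mul_eq_zero.mp hEuler.symm).resolve_left (by exact_mod_cast (by omega : n ≠ 0))

/-! ### A pencil with simple singular members -/

/-- The form `s₁ (x₁ ^ n - n x₁ x₀ ^ (n - 1)) + s₂ (x₂ ^ n - n x₂ x₀ ^ (n - 1)) + t x₀ ^ n`. For
generic `s` the singular members of this pencil with parameter `t` have a single singular zero. -/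
noncomputable def pencilForm (n : ℕ) (s : Fin 3 → S) (t : S) : MvPolynomial (Fin 3) S :=
  C (s 1) * (X 1 ^ n - C (n : S) * (X 0 ^ (n - 1) * X 1)) +
    C (s 2) * (X 2 ^ n - C (n : S) * (X 0 ^ (n - 1) * X 2)) + C t * X 0 ^ n

theorem isHomogeneous_pencilForm {n : ℕ} (hn : 0 < n) (s : Fin 3 → S) (t : S) :
    (pencilForm n s t).IsHomogeneous n := by
  have h (i : Fin 3) : (X i ^ n - C (n : S) * (X 0 ^ (n - 1) * X i)).IsHomogeneous n :=
    (isHomogeneous_X_pow i n).sub ((isHomogeneous_X_pow_mul_X hn 0 i).C_mul _)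
  exact (((h 1).C_mul _).add ((h 2).C_mul _)).add ((isHomogeneous_X_pow 0 n).C_mul t)

theorem map_pencilForm (φ : S →+* T) (n : ℕ) (s : Fin 3 → S) (t : S) :
    map φ (pencilForm n s t) = pencilForm n (φ ∘ s) (φ t) := by
  simp [pencilForm]

theorem pencilForm_eq_add (n : ℕ) (s : Fin 3 → S) (t : S) :
    pencilForm n s t = pencilForm n s 0 + C t * X 0 ^ n := by
  rw [pencilForm, pencilForm, C_0, zero_mul, add_zero]

theorem pderiv_one_pencilForm (n : ℕ) (s : Fin 3 → S) (t : S) :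
    pderiv 1 (pencilForm n s t) = C (s 1 * n) * (X 1 ^ (n - 1) - X 0 ^ (n - 1)) := by
  simp only [pencilForm, map_natCast, map_add, Derivation.leibniz, map_sub, Derivation.leibniz_pow,
    pderiv_X, Pi.single_eq_same, smul_eq_mul, mul_one, nsmul_eq_mul, ne_eq, zero_ne_one,
    not_false_eq_true, Pi.single_eq_of_ne, mul_zero, add_zero, Derivation.map_natCast,
    derivation_C, Fin.reduceEq, sub_self, C_mul]
  ring

theorem pderiv_two_pencilForm (n : ℕ) (s : Fin 3 → S) (t : S) :
    pderiv 2 (pencilForm n s t) = C (s 2 * n) * (X 2 ^ (n - 1) - X 0 ^ (n - 1)) := by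
  simp only [pencilForm, map_natCast, map_add, Derivation.leibniz, map_sub, Derivation.leibniz_pow,
    pderiv_X, ne_eq, Fin.reduceEq, not_false_eq_true, Pi.single_eq_of_ne, smul_eq_mul, mul_zero,
    add_zero, Derivation.map_natCast, sub_self, derivation_C, Pi.single_eq_same,
    mul_one, nsmul_eq_mul, zero_add, C_mul]
  ring

theorem lineRes_pencilForm (n : ℕ) (s : Fin 3 → S) (t t' : S) :
    lineRes n (pencilForm n s t) = lineRes n (pencilForm n s t') := by
  simp only [lineRes, pderiv_one_pencilForm, pderiv_two_pencilForm]

theorem eval_pencilForm {n : ℕ} (hn : 0 < n) (s : Fin 3 → S) {w : Fin 3 → S} (h0 : w 0 = 1)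
    (h1 : w 1 ^ (n - 1) = 1) (h2 : w 2 ^ (n - 1) = 1) :
    eval w (pencilForm n s 0) = (1 - n) * (s 1 * w 1 + s 2 * w 2) := by
  obtain ⟨m, rfl⟩ := Nat.exists_eq_add_one.mpr hn
  rw [Nat.add_sub_cancel] at h1 h2
  simp only [pencilForm, Nat.add_sub_cancel, map_add, map_sub, map_mul, map_pow, eval_C, eval_X,
    h0, one_pow, one_mul, pow_succ, h1, h2]
  ring

theorem injOn_eval_pencilForm {n : ℕ} (hn : 2 ≤ n) {s : Fin 3 → ℂ}
    (hs : Set.InjOn (fun w => eval w (linearForm s)) (unityPoints ![n, n - 1, n - 1] 0)) :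
    Set.InjOn (fun w => eval w (pencilForm n s 0)) (unityPoints ![n, n - 1, n - 1] 0) := by
  have hm : 0 < n - 1 := by omega
  have hn1 : (1 - n : ℂ) ≠ 0 := sub_ne_zero.mpr (by exact_mod_cast (by omega : 1 ≠ n))
  have hmem {w} (hw : w ∈ unityPoints ![n, n - 1, n - 1] 0) : w 0 = 1 ∧
      eval w (pencilForm n s 0) = (1 - n) * (s 1 * w 1 + s 2 * w 2) := by
    obtain ⟨h0, h⟩ := (mem_unityPoints (pos_vec (by omega) hm hm)).mp hw
    exact ⟨h0, eval_pencilForm (by omega) s h0 (h 1 (by decide)) (h 2 (by decide))⟩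
  intro w hw w' hw' heq
  refine hs hw hw' ?_
  obtain ⟨h0, hval⟩ := hmem hw
  obtain ⟨h0', hval'⟩ := hmem hw'
  simp only [hval, hval'] at heq
  simp only [eval_linearForm, Fin.sum_univ_three, h0, h0']
  linear_combination mul_left_cancel₀ hn1 heq

/-- The critical resultant along the pencil, as a polynomial in its parameter. -/
noncomputable def pencilCriticalRes (n : ℕ) (s : Fin 3 → ℂ) : Polynomial ℂ :=
  criticalRes n (pencilForm n (Polynomial.C ∘ s) Polynomial.X)

theorem resLine_unityForms_pencilForm (n : ℕ) (s : Fin 3 → ℂ) :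
    resLine ![n, n - 1, n - 1]
        (Function.update (unityForms ![n, n - 1, n - 1] 0) 0 (pencilForm n s 0)) 0 (X 0 ^ n) =
      res ![n, n - 1, n - 1] ![pencilForm n (Polynomial.C ∘ s) Polynomial.X,
        X 1 ^ (n - 1) - X 0 ^ (n - 1), X 2 ^ (n - 1) - X 0 ^ (n - 1)] := by
  rw [resLine, Function.update_self, map_pencilForm, map_zero, map_pow, map_X,
    ← pencilForm_eq_add]
  congr 1
  funext i
  fin_cases i
  · rfl
  · simp [unityForms]
  · simp [unityForms]

theorem exists_pencilCriticalRes_eq_C_mul {n : ℕ} (hn : 2 ≤ n) {s : Fin 3 → ℂ}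
    (hs : ∀ i, s i ≠ 0) : ∃ κ ≠ 0, pencilCriticalRes n s = Polynomial.C κ *
      resLine ![n, n - 1, n - 1]
        (Function.update (unityForms ![n, n - 1, n - 1] 0) 0 (pencilForm n s 0)) 0 (X 0 ^ n) := by
  have hm : 0 < n - 1 := by omega
  have hn0 : (n : ℂ) ≠ 0 := by exact_mod_cast (by omega : n ≠ 0)
  let c : Fin 3 → ℂ := ![1, s 1 * n, s 2 * n]
  have hc (i) : c i ≠ 0 := by
    fin_cases i
    exacts [one_ne_zero, mul_ne_zero (hs 1) hn0, mul_ne_zero (hs 2) hn0]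
  refine ⟨∏ i, c i ^ blockDegree ![n, n - 1, n - 1] i,
    Finset.prod_ne_zero_iff.mpr fun i _ => pow_ne_zero _ (hc i), ?_⟩
  have hdiff (i : Fin 3) :
      (X i ^ (n - 1) - X 0 ^ (n - 1) : MvPolynomial (Fin 3) (Polynomial ℂ)).IsHomogeneous (n - 1) :=
    (isHomogeneous_X_pow i _).sub (isHomogeneous_X_pow 0 _)
  rw [resLine_unityForms_pencilForm, map_prod]
  simp only [map_pow]
  rw [← res_C_mul (pos_vec (by omega) hm hm) (fun i => Polynomial.C (c i)) (isHomogeneous_vec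
    (isHomogeneous_pencilForm (by omega) _ _) (hdiff 1) (hdiff 2)), pencilCriticalRes, criticalRes,
    pderiv_one_pencilForm, pderiv_two_pencilForm]
  congr 1
  funext i
  fin_cases i <;> simp [c]

theorem squarefree_pencilCriticalRes {n : ℕ} (hn : 2 ≤ n) {s : Fin 3 → ℂ} (hs0 : ∀ i, s i ≠ 0)
    (hs : Set.InjOn (fun w => eval w (linearForm s)) (unityPoints ![n, n - 1, n - 1] 0)) :
    Squarefree (pencilCriticalRes n s) ∧ ¬ IsUnit (pencilCriticalRes n s) := by
  have hm : 0 < n - 1 := by omega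
  have hd := pos_vec (by omega : 0 < n) hm hm
  have hhom : (pencilForm n s 0).IsHomogeneous n := isHomogeneous_pencilForm (by omega) s 0
  obtain ⟨κ, hκ, hres⟩ := exists_pencilCriticalRes_eq_C_mul hn hs0
  have hassoc := associated_unit_mul_left
    (resLine ![n, n - 1, n - 1] (Function.update (unityForms ![n, n - 1, n - 1] 0) 0
      (pencilForm n s 0)) 0 (X 0 ^ n)) _ (Polynomial.isUnit_C.mpr hκ.isUnit)
  rw [hres, hassoc.squarefree_iff, hassoc.isUnit_iff]
  constructor
  · exact ((Polynomial.nodup_roots_iff_of_splits (resLine_unityForms_ne_zero hd hhom)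
      (IsAlgClosed.splits _)).mp (nodup_roots_resLine_unityForms hd hhom
        (injOn_eval_pencilForm hn hs))).squarefree
  · refine fun hunit => (hunit.map (Polynomial.evalRingHom (-eval 1 (pencilForm n s 0)))).ne_zero ?_
    exact (eval_resLine_unityForms_eq_zero_iff hd hhom _).mpr
      ⟨1, (mem_unityPoints hd).mpr ⟨rfl, fun i _ => one_pow _⟩, rfl⟩

theorem exists_squarefree_pencilCriticalRes {n : ℕ} (hn : 2 ≤ n) : ∃ s,
    Squarefree (pencilCriticalRes n s) ∧ ¬ IsUnit (pencilCriticalRes n s) := by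
  obtain ⟨s, hs0, hs⟩ := exists_linearForm_injOn (unityPoints ![n, n - 1, n - 1] 0)
  exact ⟨s, squarefree_pencilCriticalRes hn hs0 hs⟩

/-! ### Irreducibility of the discriminant -/

theorem polarRes_eq_mul_subst {n : ℕ} {P : MvPolynomial (Exponents n) ℤ} {N : ℕ}
    (hP : polarRes n (genericForm n) = (N : MvPolynomial (Exponents n) ℤ) * P)
    {f : MvPolynomial (Fin 3) S} (hf : f.IsHomogeneous n) :
    polarRes n f = N * subst (coeffs n f) P := by
  simpa only [map_polarRes, map_subst_genericForm hf, map_mul, map_natCast] using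
    congrArg (subst (coeffs n f)) hP

theorem exists_prime_eq_C_mul_pow {n : ℕ} (hn : 2 ≤ n) {P : MvPolynomial (Exponents n) ℤ}
    (hP : HasContentOne P) {N : ℕ} (hN : N ≠ 0)
    (hPN : polarRes n (genericForm n) = (N : MvPolynomial (Exponents n) ℤ) * P) :
    ∃ (Q : MvPolynomial (Exponents n) ℤ) (a : ℤ) (k : ℕ),
      Prime Q ∧ IsUnit a ∧ P = C a * Q ^ k := by
  let I := RingHom.ker (subst (coeffs n (singularForm n)))
  have hPI : P ∈ I := (mul_eq_zero.mp ((polarRes_eq_mul_subst hPN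
    (isHomogeneous_singularForm (by omega))).symm.trans
      (polarRes_singularForm hn))).resolve_left (Nat.cast_ne_zero.mpr hN)
  have hP0 : P ≠ 0 := fun h =>
    hasContentOne_iff_forall_prime.mp hP 2 Nat.prime_two (h ▸ dvd_zero _)
  obtain ⟨Q, hQI, hQ⟩ := (RingHom.ker_isPrime (subst (coeffs n (singularForm n)))
    ).exists_mem_prime_of_ne_bot fun h => hP0 (Ideal.mem_bot.mp (h ▸ hPI))
  obtain ⟨a, k, hk⟩ := exists_eq_C_mul_pow (P := P) hQ fun c hc => by
    have hf : (ofCoeffs c).IsHomogeneous n := isHomogeneous_ofCoeffs c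
    have hsing : IsSingular (ofCoeffs c) := (polarRes_eq_zero_iff hn hf).mp (by
      rw [polarRes_eq_mul_subst hPN hf, coeffs_ofCoeffs, hc, mul_zero])
    simpa only [coeffs_ofCoeffs] using subst_eq_zero_of_isSingular hQI hf hsing
  exact ⟨Q, a, k, hQ, hP.isUnit_of_eq_C_mul hk, hk⟩

theorem associated_pow_pencilCriticalRes {n : ℕ} (hn : 2 ≤ n) {Q : MvPolynomial (Exponents n) ℤ}
    {a : ℤ} {k N : ℕ} (hQN : polarRes n (genericForm n) =
      (N : MvPolynomial (Exponents n) ℤ) * (C a * Q ^ k)) {s : Fin 3 → ℂ}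
    (hs : pencilCriticalRes n s ≠ 0) :
    Associated (pencilCriticalRes n s)
      (subst (coeffs n (pencilForm n (Polynomial.C ∘ s) Polynomial.X)) Q ^ k) := by
  set F := pencilForm n (Polynomial.C ∘ s) Polynomial.X
  have hF : F.IsHomogeneous n := isHomogeneous_pencilForm (by omega) _ _
  have hn0 : (n : ℂ) ^ (n - 1) ^ 2 ≠ 0 := pow_ne_zero _ (by exact_mod_cast (by omega : n ≠ 0))
  have hline : lineRes n F = Polynomial.C (lineRes n (pencilForm n s 0)) := by
    rw [map_lineRes, map_pencilForm, map_zero]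
    exact lineRes_pencilForm n _ _ _
  have hres : Polynomial.C ((n : ℂ) ^ (n - 1) ^ 2) * pencilCriticalRes n s =
      Polynomial.C (lineRes n (pencilForm n s 0) * (N * a)) * subst (coeffs n F) Q ^ k := by
    have h := lineRes_mul_polarRes hn hF
    rw [hline, polarRes_eq_mul_subst hQN hF, map_mul, map_pow] at h
    rw [pencilCriticalRes]
    simp only [map_mul, map_pow, map_natCast, map_intCast]
    rw [← h, subst_C]
    ring
  have hne : lineRes n (pencilForm n s 0) * (N * a) ≠ 0 := fun h => by
    rw [h, Polynomial.C_0, zero_mul, mul_eq_zero, Polynomial.C_eq_zero] at hres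
    exact hres.elim hn0 hs
  exact (associated_unit_mul_left _ _ (Polynomial.isUnit_C.mpr hn0.isUnit)).symm.trans
    (hres ▸ associated_unit_mul_left _ _ (Polynomial.isUnit_C.mpr hne.isUnit))

theorem prime_of_polarRes_eq {n : ℕ} (hn : 2 ≤ n) {P : MvPolynomial (Exponents n) ℤ}
    (hP : HasContentOne P) {N : ℕ} (hN : N ≠ 0)
    (hPN : polarRes n (genericForm n) = (N : MvPolynomial (Exponents n) ℤ) * P) : Prime P := by
  obtain ⟨Q, a, k, hQ, ha, rfl⟩ := exists_prime_eq_C_mul_pow hn hP hN hPN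
  obtain ⟨s, hsq, hunit⟩ := exists_squarefree_pencilCriticalRes hn
  have hassoc := associated_pow_pencilCriticalRes hn hPN hsq.ne_zero
  rw [hassoc.squarefree_iff] at hsq
  rw [hassoc.isUnit_iff] at hunit
  have hk0 : k ≠ 0 := fun h => hunit (by rw [h, pow_zero]; exact isUnit_one)
  obtain rfl : k = 1 := (hsq.eq_zero_or_one_of_pow_of_not_isUnit
    (mt (IsUnit.pow k) hunit)).resolve_left hk0
  rw [pow_one]
  exact (associated_unit_mul_left Q _ (ha.map C)).symm.prime hQ

/-! ### Existence and uniqueness -/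

theorem eq_or_eq_neg_of_subst_eq_zero_iff {σ : Type*} [Finite σ] {P Q : MvPolynomial σ ℤ}
    (hP : Irreducible P) (hQ : Irreducible Q) (h : ∀ c : σ → ℂ, subst c P = 0 ↔ subst c Q = 0)
    {c : σ → ℂ} (hc : subst c P = 0) : Q = P ∨ Q = -P := by
  obtain ⟨u, rfl⟩ := associated_of_dvd_dvd
    (dvd_of_forall_subst_eq_zero hP.prime hc fun c => (h c).mp)
    (dvd_of_forall_subst_eq_zero hQ.prime ((h c).mp hc) fun c => (h c).mpr)
  obtain ⟨a, ha, hu⟩ := isUnit_iff_eq_C_of_isReduced.mp u.isUnit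
  rw [hu]
  obtain rfl | rfl := Int.isUnit_iff.mp ha
  · simp
  · simp

theorem evalAtTriple_rename_sigmaEquivProd {n : ℕ} (P : MvPolynomial (CoeffIndex fun _ => n) ℤ)
    (f : Fin 3 → MvPolynomial (Fin 3) S) :
    evalAtTriple (rename (Equiv.sigmaEquivProd (Fin 3) (Exponents n)) P) f = evalForms P f := by
  rw [evalAtTriple, aeval_eq_subst, subst_rename]
  rfl

theorem isResultant_resultant {n : ℕ} (hn : 0 < n) : IsResultant n
    (rename (Equiv.sigmaEquivProd (Fin 3) (Exponents n)) (resultant fun _ => n)) where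
  eval_eq_zero_iff f hf := by
    rw [evalAtTriple_rename_sigmaEquivProd]
    exact res_eq_zero_iff (fun _ => hn) hf
  irreducible :=
    (prime_rename_of_injective (Equiv.injective _) (prime_resultant fun _ => hn)).irreducible
  content := by
    refine hasContentOne_of_subst_eq_one (c := fun p => coeffs n (X p.1 ^ n) p.2) ?_
    rw [subst_rename]
    exact res_X_pow (d := fun _ => n) fun _ => hn
  normalized := by
    rw [evalAtTriple_rename_sigmaEquivProd]
    exact res_X_pow (d := fun _ => n) fun _ => hn

theorem IsResultant.unique {n : ℕ} {R R' : MvPolynomial (Fin 3 × Exponents n) ℤ}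
    (h : IsResultant n R) (h' : IsResultant n R') : R' = R := by
  have hzero : subst (fun _ => (0 : ℂ)) R = 0 :=
    (h.eval_eq_zero_iff (fun _ => 0) fun _ => isHomogeneous_zero _ _ _).mpr
      ⟨1, one_ne_zero, fun _ => map_zero _⟩
  have hiff (c : Fin 3 × Exponents n → ℂ) : subst c R = 0 ↔ subst c R' = 0 := by
    have hc : c = fun p => coeffs n (ofCoeffs fun u => c (p.1, u)) p.2 :=
      funext fun p => by rw [coeffs_ofCoeffs]
    have hhom (i : Fin 3) : (ofCoeffs fun u => c (i, u)).IsHomogeneous n := isHomogeneous_ofCoeffs _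
    rw [hc]
    exact (h.eval_eq_zero_iff _ hhom).trans (h'.eval_eq_zero_iff _ hhom).symm
  refine (eq_or_eq_neg_of_subst_eq_zero_iff h.irreducible h'.irreducible hiff
    hzero).resolve_right fun hneg => ?_
  have hone : -1 = (1 : ℤ) := by
    simpa only [hneg, evalAtTriple, map_neg, ← h.normalized] using h'.normalized
  omega

theorem IsDiscriminant.unique {n : ℕ} {Δ Δ' : MvPolynomial (Exponents n) ℤ}
    (h : IsDiscriminant n Δ) (h' : IsDiscriminant n Δ') : Δ' = Δ := by
  have hzero : subst (coeffs n (0 : MvPolynomial (Fin 3) ℂ)) Δ = 0 :=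
    (h.eval_eq_zero_iff 0 (isHomogeneous_zero _ _ _)).mpr
      ⟨1, one_ne_zero, map_zero _, fun i => by rw [map_zero, map_zero]⟩
  have hiff (c : Exponents n → ℂ) : subst c Δ = 0 ↔ subst c Δ' = 0 := by
    rw [← coeffs_ofCoeffs c]
    exact (h.eval_eq_zero_iff _ (isHomogeneous_ofCoeffs c)).trans
      (h'.eval_eq_zero_iff _ (isHomogeneous_ofCoeffs c)).symm
  refine (eq_or_eq_neg_of_subst_eq_zero_iff h.irreducible h'.irreducible hiff
    hzero).resolve_right fun hneg => ?_
  have hpos := h'.neg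
  rw [hneg, evalAt, map_neg, neg_lt_zero] at hpos
  exact hpos.not_gt h.neg

theorem polarRes_fermatForm_pos {n : ℕ} (hn : 2 ≤ n) :
    0 < polarRes n (fermatForm n : MvPolynomial (Fin 3) ℤ) := by
  have hd (_ : Fin 3) : 0 < n - 1 := by omega
  simp only [polarRes, pderiv_fermatForm]
  rw [res_C_mul hd _ fun i => isHomogeneous_X_pow i _, res_X_pow (d := fun _ => n - 1) hd, mul_one]
  exact Finset.prod_pos fun i _ => pow_pos (by exact_mod_cast (by omega : 0 < n)) _

theorem exists_isDiscriminant {n : ℕ} (hn : 2 ≤ n) : ∃ Δ, IsDiscriminant n Δ ∧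
    ∀ {A : Type*} [CommRing A] {f : MvPolynomial (Fin 3) A}, f.IsHomogeneous n →
      polarRes n f = -(n : A) ^ ((n - 1) ^ 2 - (n - 2)) * evalAt Δ f := by
  obtain ⟨P, hP, hPN⟩ := exists_hasContentOne_polarRes hn
  have hN : n ^ ((n - 1) ^ 2 - (n - 2)) ≠ 0 := pow_ne_zero _ (by omega)
  rw [← Nat.cast_pow] at hPN
  refine ⟨-P, ⟨fun f hf => ?_, (prime_of_polarRes_eq hn hP hN hPN).neg.irreducible,
    hP.of_dvd (neg_dvd.mpr dvd_rfl), ?_⟩, fun {A} _ f hf => ?_⟩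
  · rw [← polarRes_eq_zero_iff hn hf, polarRes_eq_mul_subst hPN hf, evalAt, aeval_eq_subst, map_neg,
      neg_eq_zero, mul_eq_zero, or_iff_right (Nat.cast_ne_zero.mpr hN)]
  · have hpos := polarRes_fermatForm_pos hn
    rw [polarRes_eq_mul_subst hPN (isHomogeneous_fermatForm n)] at hpos
    rw [evalAt, map_neg, neg_lt_zero]
    exact pos_of_mul_pos_right hpos (Nat.cast_nonneg _)
  · rw [polarRes_eq_mul_subst hPN hf, evalAt, aeval_eq_subst, map_neg, neg_mul_neg, Nat.cast_pow]

theorem evalAtTriple_pderiv_eq_polarRes {n : ℕ} {R : MvPolynomial (Fin 3 × Exponents (n - 1)) ℤ}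
    (hn : 2 ≤ n) (hR : IsResultant (n - 1) R) (f : MvPolynomial (Fin 3) S) :
    evalAtTriple R (fun i => pderiv i f) = polarRes n f := by
  rw [(isResultant_resultant (by omega)).unique hR, evalAtTriple_rename_sigmaEquivProd]
  rfl

theorem neg_sq_add_three_mul_sub_three {n : ℕ} (hn : 2 ≤ n) :
    -(n : ℤ) ^ 2 + 3 * n - 3 = -(((n - 1) ^ 2 - (n - 2) : ℕ) : ℤ) := by
  obtain ⟨m, rfl⟩ := Nat.exists_eq_add_of_le' hn
  have hle : m ≤ (m + 1) ^ 2 := by nlinarith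
  rw [show m + 2 - 1 = m + 1 by omega, Nat.add_sub_cancel, Nat.cast_sub hle]
  push_cast
  ring

end TernaryForm

theorem mainTheorem1_general (d : ℕ) (hd : 2 ≤ d) :
    (∃! Δ : MvPolynomial (TernaryForm.Exponents d) ℤ, TernaryForm.IsDiscriminant d Δ) ∧
    (∃! R : MvPolynomial (Fin 3 × TernaryForm.Exponents (d - 1)) ℤ,
      TernaryForm.IsResultant (d - 1) R) ∧
    ∀ (Δ : MvPolynomial (TernaryForm.Exponents d) ℤ)
      (R : MvPolynomial (Fin 3 × TernaryForm.Exponents (d - 1)) ℤ),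
      TernaryForm.IsDiscriminant d Δ → TernaryForm.IsResultant (d - 1) R →
      ∀ {K : Type*} [Field K], (d : K) ≠ 0 →
      ∀ f : MvPolynomial (Fin 3) K, f.IsHomogeneous d →
        TernaryForm.evalAt Δ f =
          -(d : K) ^ (-(d : ℤ) ^ 2 + 3 * (d : ℤ) - 3) *
            TernaryForm.evalAtTriple R (fun i => MvPolynomial.pderiv i f) := by
  obtain ⟨Δ₀, hΔ₀, hpolar⟩ := TernaryForm.exists_isDiscriminant hd
  have hR₀ := TernaryForm.isResultant_resultant (n := d - 1) (by omega)
  refine ⟨⟨Δ₀, hΔ₀, fun _ => hΔ₀.unique⟩, ⟨_, hR₀, fun _ => hR₀.unique⟩, ?_⟩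
  intro Δ R hΔ hR K _ hd0 f hf
  rw [hΔ₀.unique hΔ, TernaryForm.evalAtTriple_pderiv_eq_polarRes hd hR, hpolar hf,
    TernaryForm.neg_sq_add_three_mul_sub_three hd, zpow_neg, zpow_natCast, ← mul_assoc, neg_mul_neg,
    inv_mul_cancel₀ (pow_ne_zero _ hd0), one_mul]

theorem mainTheorem1 (d : ℕ) (hd : 2 ≤ d) :
    (∃! Δ : MvPolynomial (TernaryForm.Exponents d) ℤ, TernaryForm.IsDiscriminant d Δ) ∧
    (∃! R : MvPolynomial (Fin 3 × TernaryForm.Exponents (d - 1)) ℤ,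
      TernaryForm.IsResultant (d - 1) R) ∧
    ∀ (Δ : MvPolynomial (TernaryForm.Exponents d) ℤ)
      (R : MvPolynomial (Fin 3 × TernaryForm.Exponents (d - 1)) ℤ),
      TernaryForm.IsDiscriminant d Δ → TernaryForm.IsResultant (d - 1) R →
      ∀ f : MvPolynomial (Fin 3) ℂ, f.IsHomogeneous d →
        TernaryForm.evalAt Δ f =
          -(d : ℂ) ^ (-(d : ℤ) ^ 2 + 3 * (d : ℤ) - 3) *
            TernaryForm.evalAtTriple R (fun i => MvPolynomial.pderiv i f) := by
  obtain ⟨hΔ, hR, hformula⟩ := mainTheorem1_general d hd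
  exact ⟨hΔ, hR, fun Δ R hΔ hR => hformula Δ R hΔ hR (Nat.cast_ne_zero.mpr (by omega))⟩
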